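/- Conventions. $\otimes$ denotes the minimal (spatial) tensor product of unital $C^*$-algebras. A compact quantum group is a unital $C^*$-algebra $A$ with a unital *-homomorphism $\Phi : A \to A\otimes A$ that restricts, on a (necessarily unique) dense unital *-subalgebra $\mathcal A$, to the comultiplication of a Hopf *-algebra with counit $\epsilon$ and antipode $\kappa$; it is always assumed to be full, that is, the norm of $A$ restricts to the greatest $C^*$-seminorm on $\mathcal A$. It is of Kac type if $\kappa$ is a bounded *-antihomomorphism. A quantum transformation group of $(M_n(\mathbb C), \mathrm{Tr})$ is a compact quantum group $A$ with a unital *-homomorphism $\alpha : M_n(\mathbb C)\to M_n(\mathbb C)\otimes A$ such that $(\mathrm{id}\otimes\Phi)\alpha=(\alpha\otimes \mathrm{id})\alpha$, $(\mathrm{id}\otimes\epsilon)\alpha=\mathrm{id}$, $\alpha$ restricts on a dense *-subalgebra to a coaction of the Hopf *-algebra $\mathcal A$, and $(\mathrm{Tr}\otimes \mathrm{id})\alpha(b)=\mathrm{Tr}(b)1$ for all $b$. A morphism $(\tilde A,\tilde\alpha)\to(A,\alpha)$ is a unital *-homomorphism $\pi : A\to\tilde A$ with $(\pi\otimes\pi)\Phi=\tilde\Phi\pi$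 and $\tilde\alpha=(\mathrm{id}\otimes\pi)\alpha$. Theorem. Let $n\ge 1$, let $e_{ij}$ be the matrix units of $M_n(\mathbb C)$, and let $A = A_{aut}(M_n)$ be the universal unital $C^*$-algebra with generators $a^{kl}_{ij}$ ($1\le i,j,k,l\le n$) and relations, for all values of the free indices, $$\sum_{v=1}^n a^{kv}_{ij} a^{vl}_{rs} = \delta_{jr} a^{kl}_{is},\qquad \sum_{v=1}^n a^{sr}_{lv} a^{ji}_{vk} = \delta_{jr} a^{si}_{lk},\qquad (a^{kl}_{ij})^* = a^{lk}_{ji},$$ $$\sum_{r=1}^n a^{kl}_{rr} = \delta_{kl},\qquad \sum_{r=1}^n a^{rr}_{kl} = \delta_{kl}.$$ Then: (1) $A$ is a compact quantum group of Kac type, with coproduct $\Phi(a^{kl}_{ij})=\sum_{r,s} a^{kl}_{rs}\otimes a^{rs}_{ij}$. (2) The formulas $\alpha(e_{ij})=\sum_{k,l} e_{kl}\otimes a^{kl}_{ij}$ define a quantum transformation group $(A,\alpha)$ of $(M_n(\mathbb C),\mathrm{Tr})$. It is the quantum automorphism group of $(M_n(\mathbb C),\mathrm{Tr})$, both in the category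 of all compact quantum transformation groups of $(M_n(\mathbb C),\mathrm{Tr})$ and in the category of those of Kac type: every object $(\tilde A,\tilde\alpha)$ of the category has exactly one morphism to $(A,\alpha)$. Moreover it contains the ordinary automorphism group $\mathrm{Aut}(M_n(\mathbb C))$ of *-automorphisms of $M_n(\mathbb C)$ (with the topology of pointwise norm convergence), and this is its maximal subgroup: there is a surjective unital *-homomorphism $r : A\to C(\mathrm{Aut}(M_n(\mathbb C)))$, compatible with the coproducts, with $(\mathrm{id}\otimes \mathrm{ev}_g r)\alpha(b) = g(b)\otimes 1$ for all $g\in\mathrm{Aut}(M_n(\mathbb C))$ and $b\in M_n(\mathbb C)$, and every unital *-homomorphism $A\to\mathbb C$ equals $\mathrm{ev}_g r$ for exactly one $g$. -/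

import Mathlib

open scoped TensorProduct ComplexOrder

/-- A C*-seminorm on a unital *-algebra over `ℂ`. -/
structure CStarSeminorm (E : Type*) [Ring E] [StarRing E] [Algebra ℂ E] extends Seminorm ℂ E where
  mul_le' : ∀ x y : E, toFun (x * y) ≤ toFun x * toFun y
  star_mul_self' : ∀ x : E, toFun (star x * x) = toFun x ^ 2

namespace CStarSeminorm

section basic

variable {E : Type*} [Ring E] [StarRing E] [Algebra ℂ E]

instance : CoeFun (CStarSeminorm E) (fun _ => E → ℝ) := ⟨fun p => p.toFun⟩

theorem nonneg (p : CStarSeminorm E) (x : E) : 0 ≤ p x := apply_nonneg p.toSeminorm x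

theorem le_star (p : CStarSeminorm E) (x : E) : p x ≤ p (star x) := by
  have h1 : p x ^ 2 ≤ p (star x) * p x := by
    rw [← p.star_mul_self' x]; exact p.mul_le' _ _
  rcases (p.nonneg x).eq_or_lt with h | h
  · rw [← h]; exact p.nonneg _
  · nlinarith

theorem star_eq (p : CStarSeminorm E) (x : E) : p (star x) = p x :=
  le_antisymm (by simpa using p.le_star (star x)) (p.le_star x)

/-- The *-algebra `E`, regarded as a seminormed space by means of the C*-seminorm `p`. -/
def Pre (_p : CStarSeminorm E) : Type _ := E

variable (p : CStarSeminorm E)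

instance : Ring p.Pre := inferInstanceAs (Ring E)
instance : StarRing p.Pre := inferInstanceAs (StarRing E)
instance : Algebra ℂ p.Pre := inferInstanceAs (Algebra ℂ E)
instance [StarModule ℂ E] : StarModule ℂ p.Pre := inferInstanceAs (StarModule ℂ E)

/-- The identity map of `E`, with values in the seminormed space. -/
def toPre : E →⋆ₐ[ℂ] p.Pre := StarAlgHom.id ℂ E

instance : SeminormedRing p.Pre :=
  { (inferInstance : Ring p.Pre),
    p.toSeminorm.toAddGroupSeminorm.toSeminormedAddCommGroup with
    norm_mul_le := p.mul_le' }

instance : NormedAlgebra ℂ p.Pre where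
  norm_smul_le a x := (p.smul' a x).le

theorem norm_toPre (x : E) : ‖p.toPre x‖ = p x := rfl

theorem norm_star_pre (x : p.Pre) : ‖star x‖ = ‖x‖ := p.star_eq x

/-- Separation and completion of `E` with respect to `p`. -/
abbrev Raw : Type _ := UniformSpace.Completion p.Pre

noncomputable instance : NormedAlgebra ℂ p.Raw where
  norm_smul_le a x := norm_smul_le a x

theorem uniformContinuous_star_pre : UniformContinuous (star : p.Pre → p.Pre) := by
  refine (LipschitzWith.of_dist_le_mul (K := 1) fun x y => ?_).uniformContinuous
  rw [dist_eq_norm, dist_eq_norm, ← star_sub, norm_star_pre]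
  simp

noncomputable instance : Star p.Raw where
  star := UniformSpace.Completion.map (star : p.Pre → p.Pre)

@[fun_prop]
theorem continuous_star_completion : Continuous (star : p.Raw → p.Raw) :=
  UniformSpace.Completion.continuous_map

theorem star_coe (x : p.Pre) : star (x : p.Raw) = ((star x : p.Pre) : p.Raw) :=
  UniformSpace.Completion.map_coe p.uniformContinuous_star_pre x

noncomputable instance : StarRing p.Raw where
  star_involutive x := by
    refine UniformSpace.Completion.induction_on x
      (isClosed_eq (p.continuous_star_completion.comp p.continuous_star_completion)
        continuous_id) fun x => ?_
    rw [star_coe, star_coe, star_star]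
  star_mul x y := by
    have hs := p.continuous_star_completion
    refine UniformSpace.Completion.induction_on₂ x y
      (isClosed_eq (by fun_prop) (by fun_prop)) fun x y => ?_
    simp only [star_coe, ← UniformSpace.Completion.coe_mul, star_mul]
  star_add x y := by
    have hs := p.continuous_star_completion
    refine UniformSpace.Completion.induction_on₂ x y
      (isClosed_eq (by fun_prop) (by fun_prop)) fun x y => ?_
    simp only [star_coe, ← UniformSpace.Completion.coe_add, star_add]

instance : CStarRing p.Raw where
  norm_mul_self_le x := by
    have hs := p.continuous_star_completion
    refine UniformSpace.Completion.induction_on x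
      (isClosed_le (by fun_prop) (by fun_prop)) fun x => ?_
    rw [star_coe, ← UniformSpace.Completion.coe_mul, UniformSpace.Completion.norm_coe,
      UniformSpace.Completion.norm_coe, ← sq]
    exact (p.star_mul_self' x).ge

theorem uniformContinuous_of_le {C : Type*} [CStarAlgebra C] (f : E →⋆ₐ[ℂ] C) (hf : ∀ x, ‖f x‖ ≤ p x) :
    UniformContinuous (fun x : p.Pre => f x) := by
  refine (LipschitzWith.of_dist_le_mul (K := 1) fun x y => ?_).uniformContinuous
  rw [dist_eq_norm, dist_eq_norm, NNReal.coe_one, one_mul]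
  exact (congrArg norm (map_sub f x y)).symm.le.trans (hf (x - y))

end basic

variable {E : Type*} [Ring E] [StarRing E] [Algebra ℂ E] [StarModule ℂ E]

instance (p : CStarSeminorm E) : StarModule ℂ p.Raw where
  star_smul c x := by
    have hs := p.continuous_star_completion
    have hc : ∀ c : ℂ, Continuous (fun x : p.Raw => c • x) := fun c =>
      UniformSpace.Completion.continuous_map
    refine UniformSpace.Completion.induction_on x
      (isClosed_eq (hs.comp (hc c)) ((hc (star c)).comp hs)) fun x => ?_
    rw [star_coe]
    refine (congrArg star (UniformSpace.Completion.coe_smul c x).symm).trans ?_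
    rw [star_coe, star_smul]
    exact UniformSpace.Completion.coe_smul (star c) (star x)

noncomputable instance (p : CStarSeminorm E) : CStarAlgebra p.Raw where

/-- The C*-algebra obtained from the *-algebra `E` by separation and completion with respect to the
C*-seminorm `p`. -/
def Completion (p : CStarSeminorm E) : Type _ := p.Raw

noncomputable instance (p : CStarSeminorm E) : CStarAlgebra p.Completion :=
  inferInstanceAs (CStarAlgebra p.Raw)

/-- The canonical map of the *-algebra to its completion. -/
noncomputable def ofRaw (p : CStarSeminorm E) : E →⋆ₐ[ℂ] p.Raw where
  toFun x := (p.toPre x : p.Raw)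
  map_one' := by rw [map_one, UniformSpace.Completion.coe_one]
  map_mul' x y := by rw [map_mul, UniformSpace.Completion.coe_mul]
  map_zero' := by rw [map_zero, UniformSpace.Completion.coe_zero]
  map_add' x y := by rw [map_add, UniformSpace.Completion.coe_add]
  commutes' c := by
    rw [Algebra.algebraMap_eq_smul_one, Algebra.algebraMap_eq_smul_one, map_smul, map_one]
    exact UniformSpace.Completion.coe_smul c (1 : p.Pre)
  map_star' x := by rw [map_star, star_coe]

/-- The canonical *-homomorphism of the *-algebra to its completion. -/
noncomputable def of (p : CStarSeminorm E) : E →⋆ₐ[ℂ] p.Completion := p.ofRaw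

theorem norm_of (p : CStarSeminorm E) (x : E) : ‖p.of x‖ = p x :=
  UniformSpace.Completion.norm_coe (p.toPre x)

theorem denseRange_of (p : CStarSeminorm E) : DenseRange p.of :=
  UniformSpace.Completion.denseRange_coe (α := p.Pre)

theorem completion_induction (p : CStarSeminorm E) {P : p.Completion → Prop} (x : p.Completion)
    (hc : IsClosed {x | P x}) (h : ∀ x : E, P (p.of x)) : P x :=
  p.denseRange_of.induction_on x hc h

variable {C : Type*} [CStarAlgebra C]

/-- The extension of a *-homomorphism that is contractive for `p` to the completion, as a map. -/
noncomputable def liftFun (p : CStarSeminorm E) (f : E →⋆ₐ[ℂ] C) : p.Completion → C :=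
  UniformSpace.Completion.extension (fun x : p.Pre => f x)

theorem continuous_liftFun (p : CStarSeminorm E) (f : E →⋆ₐ[ℂ] C) : Continuous (p.liftFun f) :=
  UniformSpace.Completion.continuous_extension

theorem liftFun_of (p : CStarSeminorm E) (f : E →⋆ₐ[ℂ] C) (hf : ∀ x, ‖f x‖ ≤ p x) (x : E) :
    p.liftFun f (p.of x) = f x :=
  UniformSpace.Completion.extension_coe (p.uniformContinuous_of_le f hf) (p.toPre x)

/-- A *-homomorphism that is contractive for `p` extends to the completion. -/
noncomputable def lift (p : CStarSeminorm E) (f : E →⋆ₐ[ℂ] C) (hf : ∀ x, ‖f x‖ ≤ p x) :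
    p.Completion →⋆ₐ[ℂ] C where
  toFun := p.liftFun f
  map_one' := by rw [← map_one p.of, p.liftFun_of f hf, map_one]
  map_zero' := by rw [← map_zero p.of, p.liftFun_of f hf, map_zero]
  map_mul' x y := by
    have hc := p.continuous_liftFun f
    refine p.completion_induction
      (P := fun x => p.liftFun f (x * y) = p.liftFun f x * p.liftFun f y) x
      (isClosed_eq (by fun_prop) (by fun_prop)) fun x => ?_
    refine p.completion_induction
      (P := fun y => p.liftFun f (p.of x * y) = p.liftFun f (p.of x) * p.liftFun f y) y
      (isClosed_eq (by fun_prop) (by fun_prop)) fun y => ?_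
    rw [← map_mul, p.liftFun_of f hf, p.liftFun_of f hf, p.liftFun_of f hf, map_mul]
  map_add' x y := by
    have hc := p.continuous_liftFun f
    refine p.completion_induction
      (P := fun x => p.liftFun f (x + y) = p.liftFun f x + p.liftFun f y) x
      (isClosed_eq (by fun_prop) (by fun_prop)) fun x => ?_
    refine p.completion_induction
      (P := fun y => p.liftFun f (p.of x + y) = p.liftFun f (p.of x) + p.liftFun f y) y
      (isClosed_eq (by fun_prop) (by fun_prop)) fun y => ?_
    rw [← map_add, p.liftFun_of f hf, p.liftFun_of f hf, p.liftFun_of f hf, map_add]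
  commutes' c := by
    rw [← AlgHomClass.commutes p.of c, p.liftFun_of f hf, AlgHomClass.commutes f c]
  map_star' x := by
    have hc := p.continuous_liftFun f
    refine p.completion_induction
      (P := fun x => p.liftFun f (star x) = star (p.liftFun f x)) x
      (isClosed_eq (by fun_prop) (by fun_prop)) fun x => ?_
    rw [← map_star, p.liftFun_of f hf, p.liftFun_of f hf, map_star]

theorem lift_of (p : CStarSeminorm E) (f : E →⋆ₐ[ℂ] C) (hf : ∀ x, ‖f x‖ ≤ p x) (x : E) :
    p.lift f hf (p.of x) = f x := p.liftFun_of f hf x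

end CStarSeminorm

namespace CStarSeminorm

/-- The C*-seminorm `p` determined by a set `S` of positive functionals: `p t` is the least `c ≥ 0`
with `ω (t* t) ≤ c² ω 1` for all `ω` in `S`. -/
noncomputable def ofFunctionals {E : Type*} [Ring E] [StarRing E] [Algebra ℂ E] [StarModule ℂ E]
    (S : Set (E →ₗ[ℂ] ℂ))
    (hpos : ∀ ω ∈ S, ∀ x : E, 0 ≤ (ω (star x * x)).re)
    (hconj : ∀ ω ∈ S, ∀ y : E, ∃ ω' ∈ S, ∀ x, ω' x = ω (star y * x * y))
    (hbdd : ∀ t : E, ∃ c : ℝ, 0 ≤ c ∧ ∀ ω ∈ S, (ω (star t * t)).re ≤ c ^ 2 * (ω 1).re) :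
    CStarSeminorm E :=
  let N : E → ℝ := fun t =>
    sInf {c : ℝ | 0 ≤ c ∧ ∀ ω ∈ S, (ω (star t * t)).re ≤ c ^ 2 * (ω 1).re}
  have hne : ∀ t : E, {c : ℝ | 0 ≤ c ∧
      ∀ ω ∈ S, (ω (star t * t)).re ≤ c ^ 2 * (ω 1).re}.Nonempty := hbdd
  have hbb : ∀ t : E, BddBelow {c : ℝ | 0 ≤ c ∧
      ∀ ω ∈ S, (ω (star t * t)).re ≤ c ^ 2 * (ω 1).re} := fun t => ⟨0, fun c hc => hc.1⟩
  have h1 : ∀ ω ∈ S, 0 ≤ (ω 1).re := fun ω hω => by simpa using hpos ω hω 1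
  have hN0 : ∀ t, 0 ≤ N t := fun t => le_csInf (hne t) fun c hc => hc.1
  have hle : ∀ t c, 0 ≤ c → (∀ ω ∈ S, (ω (star t * t)).re ≤ c ^ 2 * (ω 1).re) → N t ≤ c :=
    fun t c h0 h => csInf_le (hbb t) ⟨h0, h⟩
  have hlt : ∀ t c, N t < c → ∀ ω ∈ S, (ω (star t * t)).re ≤ c ^ 2 * (ω 1).re := by
    intro t c hc ω hω
    obtain ⟨d, hd, hdc⟩ := exists_lt_of_csInf_lt (hne t) hc
    refine (hd.2 ω hω).trans ?_
    have := h1 ω hω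
    have := hd.1
    gcongr
  have hspec : ∀ t, ∀ ω ∈ S, (ω (star t * t)).re ≤ N t ^ 2 * (ω 1).re := by
    intro t ω hω
    have hcont : Continuous fun c : ℝ => c ^ 2 * (ω 1).re := by fun_prop
    refine ge_of_tendsto (hcont.tendsto (N t) |>.mono_left
      (nhdsWithin_le_nhds (s := Set.Ioi (N t)))) ?_
    filter_upwards [self_mem_nhdsWithin] with c hc using hlt t c hc ω hω
  have hmul : ∀ s t, N (s * t) ≤ N s * N t := by
    intro s t
    refine hle _ _ (mul_nonneg (hN0 s) (hN0 t)) fun ω hω => ?_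
    obtain ⟨ω', hω', he⟩ := hconj ω hω t
    have e1 : ω (star (s * t) * (s * t)) = ω' (star s * s) := by
      rw [he, star_mul]; congr 1; noncomm_ring
    have e2 : ω' 1 = ω (star t * t) := by rw [he, mul_one]
    rw [e1]
    have a1 := hspec s ω' hω'
    have a2 := hspec t ω hω
    rw [e2] at a1
    have := sq_nonneg (N s)
    nlinarith
  have hsq : ∀ t, N t ^ 2 ≤ N (star t * t) := by
    intro t
    refine le_of_forall_gt fun c hc => ?_
    obtain ⟨d, hd, hdc⟩ := exists_between hc
    have hd0 : 0 < d := (hN0 _).trans_lt hd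
    refine lt_of_le_of_lt ?_ hdc
    have : N t ≤ Real.sqrt d := by
      refine hle _ _ (Real.sqrt_nonneg d) fun ω hω => ?_
      rw [Real.sq_sqrt hd0.le]
      have a1 := hlt _ _ hd ω hω
      have a2 := hpos ω hω ((d : ℂ) • (1 : E) - star t * t)
      have e : star ((d : ℂ) • (1 : E) - star t * t) * ((d : ℂ) • (1 : E) - star t * t)
          = ((d : ℂ) ^ 2) • (1 : E) - (2 * (d : ℂ)) • (star t * t)
            + star (star t * t) * (star t * t) := by
        simp only [star_sub, star_smul, star_one, star_mul, star_star, sub_mul, mul_sub,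
          smul_mul_assoc, mul_smul_comm, one_mul, mul_one, sq, Complex.star_def,
          Complex.conj_ofReal]
        module
      rw [e, map_add, map_sub, map_smul, map_smul] at a2
      have e3 : (((d : ℂ) ^ 2) • ω 1).re = d ^ 2 * (ω 1).re := by
        rw [← Complex.ofReal_pow, smul_eq_mul, Complex.re_ofReal_mul]
      have e4 : ((2 * (d : ℂ)) • ω (star t * t)).re = 2 * d * (ω (star t * t)).re := by
        rw [smul_eq_mul, ← Complex.re_ofReal_mul]; push_cast; rfl
      rw [Complex.add_re, Complex.sub_re, e3, e4] at a2
      nlinarith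
    calc N t ^ 2 ≤ Real.sqrt d ^ 2 := by have := hN0 t; gcongr
      _ = d := Real.sq_sqrt hd0.le
  have hstar : ∀ t, N t ≤ N (star t) := by
    intro t
    have a := (hsq t).trans (hmul (star t) t)
    rcases (hN0 t).eq_or_lt with h | h
    · rw [← h]; exact hN0 _
    · nlinarith
  have hadd : ∀ s t, N (s + t) ≤ N s + N t := by
    intro s t
    refine le_of_forall_pos_le_add fun ε hε => ?_
    have hs : N s < N s + ε / 2 := by linarith
    have ht : N t < N t + ε / 2 := by linarith
    have hc : 0 < N s + ε / 2 := (hN0 s).trans_lt hs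
    have hd : 0 < N t + ε / 2 := (hN0 t).trans_lt ht
    have e0 : N s + N t + ε = (N s + ε / 2) + (N t + ε / 2) := by ring
    rw [e0]
    refine hle _ _ (by positivity) fun ω hω => ?_
    have a1 := hlt _ _ hs ω hω
    have a2 := hlt _ _ ht ω hω
    generalize N s + ε / 2 = c at *
    generalize N t + ε / 2 = d at *
    have a3 := hpos ω hω ((d : ℂ) • s - (c : ℂ) • t)
    have e1 : star (s + t) * (s + t)
        = star s * s + (star s * t + star t * s) + star t * t := by
      rw [star_add]; noncomm_ring
    have e2 : star ((d : ℂ) • s - (c : ℂ) • t) * ((d : ℂ) • s - (c : ℂ) • t)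
        = ((d : ℂ) ^ 2) • (star s * s) - ((c : ℂ) * d) • (star s * t + star t * s)
          + ((c : ℂ) ^ 2) • (star t * t) := by
      simp only [star_sub, star_smul, sub_mul, mul_sub, smul_mul_assoc, mul_smul_comm,
        sq, Complex.star_def, Complex.conj_ofReal]
      module
    have r1 : ∀ (x : ℝ) (z : ℂ), ((x : ℂ) • z).re = x * z.re := fun x z => by
      rw [smul_eq_mul, Complex.re_ofReal_mul]
    rw [e2, map_add, map_sub, map_smul, map_smul, map_smul, ← Complex.ofReal_pow,
      ← Complex.ofReal_pow, ← Complex.ofReal_mul, Complex.add_re, Complex.sub_re, r1, r1, r1] at a3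
    rw [e1, map_add, map_add, Complex.add_re, Complex.add_re]
    have hcd : 0 < c * d := mul_pos hc hd
    refine le_of_mul_le_mul_left ?_ hcd
    have b1 : 0 ≤ d * (c + d) := by positivity
    have b2 : 0 ≤ c * (c + d) := by positivity
    nlinarith [mul_le_mul_of_nonneg_left a1 b1, mul_le_mul_of_nonneg_left a2 b2]
  have hsq' : ∀ t, N (star t * t) ≤ N t ^ 2 := by
    intro t
    have a := hstar (star t)
    rw [star_star] at a
    have := hN0 t
    have := hmul (star t) t
    nlinarith
  { Seminorm.ofSMulLE N
      (le_antisymm (hle 0 0 le_rfl fun ω _ => by simp) (hN0 0)) hadd (by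
        intro c t
        refine hle _ _ (mul_nonneg (norm_nonneg c) (hN0 t)) fun ω hω => ?_
        have e : star (c • t) * (c • t) = ((‖c‖ ^ 2 : ℝ) : ℂ) • (star t * t) := by
          rw [star_smul, smul_mul_smul_comm, Complex.star_def, Complex.conj_mul']
          push_cast; rfl
        rw [e, map_smul, smul_eq_mul, Complex.re_ofReal_mul, mul_pow, mul_assoc]
        exact mul_le_mul_of_nonneg_left (hspec t ω hω) (by positivity)) with
    mul_le' := hmul
    star_mul_self' := fun t => le_antisymm (hsq' t) (hsq t) }

end CStarSeminorm

/-- A positive kernel on a unital *-algebra `E`, indexed by a finite set `ι`: a matrix `(φ i j)` of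
linear functionals with `∑ φ i j ((x i)* (x j)) ≥ 0` for all families `x`; in other words, a positive
functional `(x i j) ↦ ∑ φ i j (x i j)` on the *-algebra of `ι × ι` matrices over `E`.

For a C*-algebra, by the GNS construction, these are exactly the matrices
`φ i j a = ⟨ξ i, π a (ξ j)⟩` for a *-representation `π` on a Hilbert space and vectors `ξ i`. -/
structure PosKernel (ι : Type) [Fintype ι] (E : Type*) [Ring E] [StarRing E] [Algebra ℂ E] where
  fn : ι → ι → E →ₗ[ℂ] ℂ
  nonneg' : ∀ x : ι → E, 0 ≤ ∑ i, ∑ j, fn i j (star (x i) * x j)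

namespace PosKernel

/-- The product functional `∑ φ i j ⊗ ψ i j` of two positive kernels. If
`φ i j a = ⟨ξ i, π a (ξ j)⟩` and `ψ i j b = ⟨η i, ρ b (η j)⟩`, then it is the vector functional
`t ↦ ⟨ζ, (π ⊗ ρ)(t) ζ⟩` of the vector `ζ = ∑ ξ i ⊗ η i`. -/
noncomputable def prod {A B : Type*} [Ring A] [StarRing A] [Algebra ℂ A] [Ring B] [StarRing B]
    [Algebra ℂ B] {ι : Type} [Fintype ι] (φ : PosKernel ι A) (ψ : PosKernel ι B) :
    A ⊗[ℂ] B →ₗ[ℂ] ℂ :=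
  ∑ i, ∑ j, LinearMap.mul' ℂ ℂ ∘ₗ TensorProduct.map (φ.fn i j) (ψ.fn i j)

theorem prod_tmul {A B : Type*} [Ring A] [StarRing A] [Algebra ℂ A] [Ring B] [StarRing B]
    [Algebra ℂ B] {ι : Type} [Fintype ι] (φ : PosKernel ι A) (ψ : PosKernel ι B) (a : A) (b : B) :
    φ.prod ψ (a ⊗ₜ b) = ∑ i, ∑ j, φ.fn i j a * ψ.fn i j b := by
  simp [prod, LinearMap.sum_apply]

/-- The pull back of a positive kernel along a *-homomorphism. -/
def comp {A C : Type*} [Ring A] [StarRing A] [Algebra ℂ A] [Ring C] [StarRing C]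
    [Algebra ℂ C] {ι : Type} [Fintype ι] (φ : PosKernel ι C) (f : A →⋆ₐ[ℂ] C) :
    PosKernel ι A where
  fn i j := φ.fn i j ∘ₗ f.toAlgHom.toLinearMap
  nonneg' x := by simpa [StarHomClass.map_star] using φ.nonneg' (fun i => f (x i))

/-- The kernel `φ i j ((c k)* a (c l))`, indexed by pairs. -/
def compress {A : Type*} [Ring A] [StarRing A] [Algebra ℂ A] {ι κ : Type} [Fintype ι] [Fintype κ]
    (φ : PosKernel ι A) (c : κ → A) : PosKernel (ι × κ) A where
  fn p q := φ.fn p.1 q.1 ∘ₗ LinearMap.mulLeft ℂ (star (c p.2)) ∘ₗ LinearMap.mulRight ℂ (c q.2)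
  nonneg' x := by
    have h := φ.nonneg' (fun i => ∑ k, x (i, k) * c k)
    convert h using 1
    simp only [Fintype.sum_prod_type, star_sum, Finset.sum_mul_sum, map_sum, star_mul,
      LinearMap.comp_apply, LinearMap.mulLeft_apply, LinearMap.mulRight_apply]
    refine Finset.sum_congr rfl fun i _ => ?_
    rw [Finset.sum_comm]
    refine Finset.sum_congr rfl fun j _ => ?_
    refine Finset.sum_congr rfl fun k _ => ?_
    refine Finset.sum_congr rfl fun l _ => ?_
    simp only [mul_assoc]

theorem gram_posSemidef {A : Type*} [Ring A] [StarRing A] [Algebra ℂ A] [StarModule ℂ A]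
    {ι κ : Type} [Fintype ι] [Fintype κ] (φ : PosKernel ι A) (c : κ → A) :
    (Matrix.of fun p q : ι × κ => φ.fn p.1 q.1 (star (c p.2) * c q.2)).PosSemidef := by
  classical
  rw [← Matrix.isPositive_toEuclideanLin_iff, LinearMap.isPositive_iff_complex]
  intro v
  have h : inner ℂ (Matrix.toEuclideanLin (Matrix.of fun p q : ι × κ =>
      φ.fn p.1 q.1 (star (c p.2) * c q.2)) v) v
      = star (∑ i, ∑ j, φ.fn i j (star (∑ k, v (i, k) • c k) * (∑ k, v (j, k) • c k))) := by
    rw [← inner_conj_symm, ← starRingEnd_apply]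
    congr 1
    rw [EuclideanSpace.inner_eq_star_dotProduct]
    simp only [Matrix.ofLp_toLpLin, Matrix.toLin'_apply, dotProduct, Matrix.mulVec,
      Fintype.sum_prod_type, Matrix.of_apply, Pi.star_apply, Finset.sum_mul]
    refine Finset.sum_congr rfl fun i _ => ?_
    refine Finset.sum_comm.trans ?_
    refine Finset.sum_congr rfl fun j _ => ?_
    rw [star_sum, Finset.sum_mul_sum, map_sum]
    refine Finset.sum_congr rfl fun k _ => ?_
    rw [map_sum]
    refine Finset.sum_congr rfl fun l _ => ?_
    rw [star_smul, smul_mul_smul_comm, map_smul, smul_eq_mul]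
    ring
  have h2 := φ.nonneg' (fun i => ∑ k, v (i, k) • c k)
  rw [h, (IsSelfAdjoint.of_nonneg h2).star_eq]
  obtain ⟨h3, h4⟩ := Complex.nonneg_iff.1 h2
  exact ⟨Complex.ext rfl h4, h3⟩

theorem exists_fin_sum {A B : Type*} [Ring A] [Algebra ℂ A] [Ring B] [Algebra ℂ B]
    (t : A ⊗[ℂ] B) : ∃ (m : ℕ) (a : Fin m → A) (b : Fin m → B), t = ∑ k, a k ⊗ₜ b k := by
  induction t with
  | zero => exact ⟨0, Fin.elim0, Fin.elim0, by simp⟩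
  | tmul a b => exact ⟨1, fun _ => a, fun _ => b, by simp⟩
  | add s t hs ht =>
    obtain ⟨m, a, b, rfl⟩ := hs
    obtain ⟨m', a', b', rfl⟩ := ht
    exact ⟨m + m', Fin.append a a', Fin.append b b', by simp [Fin.sum_univ_add]⟩

theorem sum_rotate {ι κ : Type} [Fintype ι] [Fintype κ] (F : ι → κ → ι → κ → ℂ) :
    ∑ i, ∑ k, ∑ j, ∑ l, F i k j l = ∑ l, ∑ k, ∑ i, ∑ j, F i k j l := by
  calc ∑ i, ∑ k, ∑ j, ∑ l, F i k j l = ∑ k, ∑ i, ∑ j, ∑ l, F i k j l := Finset.sum_comm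
    _ = ∑ k, ∑ i, ∑ l, ∑ j, F i k j l := by
      refine Finset.sum_congr rfl fun k _ => Finset.sum_congr rfl fun i _ => Finset.sum_comm
    _ = ∑ k, ∑ l, ∑ i, ∑ j, F i k j l :=
      Finset.sum_congr rfl fun k _ => Finset.sum_comm
    _ = ∑ l, ∑ k, ∑ i, ∑ j, F i k j l := Finset.sum_comm

theorem prod_conj {A B : Type*} [Ring A] [StarRing A] [Algebra ℂ A] [StarModule ℂ A]
    [Ring B] [StarRing B] [Algebra ℂ B] [StarModule ℂ B] {ι κ : Type} [Fintype ι] [Fintype κ]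
    (φ : PosKernel ι A) (ψ : PosKernel ι B) (a : κ → A) (b : κ → B) (t : A ⊗[ℂ] B) :
    (φ.compress a).prod (ψ.compress b) t =
      φ.prod ψ (star (∑ k, a k ⊗ₜ[ℂ] b k) * t * ∑ k, a k ⊗ₜ[ℂ] b k) := by
  induction t with
  | zero => simp
  | add s t hs ht => simp only [map_add, hs, ht, mul_add, add_mul]
  | tmul x y =>
    rw [prod_tmul]
    simp only [star_sum, TensorProduct.star_tmul, Finset.sum_mul, Finset.mul_sum,
      Algebra.TensorProduct.tmul_mul_tmul, map_sum, prod_tmul, Fintype.sum_prod_type, compress,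
      LinearMap.comp_apply, LinearMap.mulLeft_apply, LinearMap.mulRight_apply, mul_assoc]
    exact sum_rotate fun i k j l => φ.fn i j (star (a k) * (x * a l)) * ψ.fn i j (star (b k) * (y * b l))

theorem prod_nonneg {A B : Type*} [Ring A] [StarRing A] [Algebra ℂ A] [StarModule ℂ A]
    [Ring B] [StarRing B] [Algebra ℂ B] [StarModule ℂ B] {ι : Type} [Fintype ι]
    (φ : PosKernel ι A) (ψ : PosKernel ι B) (t : A ⊗[ℂ] B) : 0 ≤ φ.prod ψ (star t * t) := by
  classical
  obtain ⟨m, a, b, rfl⟩ := exists_fin_sum t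
  have h := ((φ.gram_posSemidef a).hadamard (ψ.gram_posSemidef b)).dotProduct_mulVec_nonneg 1
  convert h using 1
  simp only [star_sum, TensorProduct.star_tmul, Finset.sum_mul_sum,
      Algebra.TensorProduct.tmul_mul_tmul, map_sum, prod_tmul, dotProduct, Matrix.mulVec,
      Fintype.sum_prod_type, Matrix.hadamard_apply, Matrix.of_apply, Pi.star_apply, Pi.one_apply,
      star_one, one_mul, mul_one]
  exact Finset.sum_comm.trans (sum_rotate fun i k j l =>
    φ.fn i j (star (a k) * a l) * ψ.fn i j (star (b k) * b l)).symm

end PosKernel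

/-! ### The minimal (spatial) tensor product of C*-algebras -/

section MinTensor

variable {A B C D : Type*} [CStarAlgebra A] [CStarAlgebra B] [CStarAlgebra C] [CStarAlgebra D]

/-- The vector functionals on the algebraic tensor product `A ⊗ B`: the functionals
`t ↦ ⟨ζ, (π ⊗ ρ)(t) ζ⟩`, where `π`, `ρ` are *-representations of `A`, `B` on Hilbert spaces `H`, `K`
and `ζ` is a vector of the algebraic tensor product of `H` and `K`. -/
def vectorFunctionals (A B : Type*) [CStarAlgebra A] [CStarAlgebra B] :
    Set (A ⊗[ℂ] B →ₗ[ℂ] ℂ) :=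
  {ω | ∃ (ι : Type) (_ : Fintype ι) (φ : PosKernel ι A) (ψ : PosKernel ι B), ω = φ.prod ψ}

theorem vectorFunctionals_pos (ω : A ⊗[ℂ] B →ₗ[ℂ] ℂ) (hω : ω ∈ vectorFunctionals A B)
    (t : A ⊗[ℂ] B) : 0 ≤ (ω (star t * t)).re := by
  obtain ⟨ι, _, φ, ψ, rfl⟩ := hω
  exact (Complex.nonneg_iff.1 (φ.prod_nonneg ψ t)).1

theorem vectorFunctionals_conj (ω : A ⊗[ℂ] B →ₗ[ℂ] ℂ) (hω : ω ∈ vectorFunctionals A B)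
    (y : A ⊗[ℂ] B) : ∃ ω' ∈ vectorFunctionals A B, ∀ x, ω' x = ω (star y * x * y) := by
  obtain ⟨ι, _, φ, ψ, rfl⟩ := hω
  obtain ⟨m, a, b, rfl⟩ := PosKernel.exists_fin_sum y
  exact ⟨_, ⟨ι × Fin m, inferInstance, φ.compress a, ψ.compress b, rfl⟩,
    fun x => φ.prod_conj ψ a b x⟩

theorem exists_star_mul_self_add (a : A) :
    ∃ b : A, star b * b + star a * a = algebraMap ℂ A ((‖a‖ ^ 2 : ℝ) : ℂ) := by
  let _ := CStarAlgebra.spectralOrder A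
  have _ := CStarAlgebra.spectralOrderedRing A
  have h : star a * a ≤ algebraMap ℝ A (‖a‖ ^ 2) := CStarAlgebra.star_mul_le_algebraMap_norm_sq
  obtain ⟨b, hb⟩ := CStarAlgebra.nonneg_iff_eq_star_mul_self.1 (sub_nonneg.2 h)
  refine ⟨b, ?_⟩
  rw [← hb, sub_add_cancel]
  rfl

theorem vectorFunctionals_bdd (t : A ⊗[ℂ] B) : ∃ c : ℝ, 0 ≤ c ∧
    ∀ ω ∈ vectorFunctionals A B, (ω (star t * t)).re ≤ c ^ 2 * (ω 1).re := by
  have hl : ∀ a : A, ∀ ω ∈ vectorFunctionals A B,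
      (ω (star (a ⊗ₜ[ℂ] (1 : B)) * (a ⊗ₜ[ℂ] (1 : B)))).re ≤ ‖a‖ ^ 2 * (ω 1).re := by
    intro a ω hω
    obtain ⟨b, hb⟩ := exists_star_mul_self_add a
    have h := vectorFunctionals_pos ω hω (b ⊗ₜ[ℂ] (1 : B))
    have e : star (b ⊗ₜ[ℂ] (1 : B)) * (b ⊗ₜ[ℂ] (1 : B)) + star (a ⊗ₜ[ℂ] (1 : B)) * (a ⊗ₜ[ℂ] (1 : B))
        = ((‖a‖ ^ 2 : ℝ) : ℂ) • 1 := by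
      simp only [TensorProduct.star_tmul, Algebra.TensorProduct.tmul_mul_tmul, star_one, one_mul,
        ← TensorProduct.add_tmul, hb, Algebra.algebraMap_eq_smul_one, ← TensorProduct.smul_tmul',
        Algebra.TensorProduct.one_def]
    have e2 := congrArg (fun x => (ω x).re) e
    simp only [map_add, map_smul, Complex.add_re, smul_eq_mul, Complex.re_ofReal_mul] at e2
    linarith
  have hr : ∀ b : B, ∀ ω ∈ vectorFunctionals A B,
      (ω (star ((1 : A) ⊗ₜ[ℂ] b) * ((1 : A) ⊗ₜ[ℂ] b))).re ≤ ‖b‖ ^ 2 * (ω 1).re := by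
    intro a ω hω
    obtain ⟨b, hb⟩ := exists_star_mul_self_add a
    have h := vectorFunctionals_pos ω hω ((1 : A) ⊗ₜ[ℂ] b)
    have e : star ((1 : A) ⊗ₜ[ℂ] b) * ((1 : A) ⊗ₜ[ℂ] b) + star ((1 : A) ⊗ₜ[ℂ] a) * ((1 : A) ⊗ₜ[ℂ] a)
        = ((‖a‖ ^ 2 : ℝ) : ℂ) • 1 := by
      simp only [TensorProduct.star_tmul, Algebra.TensorProduct.tmul_mul_tmul, star_one, one_mul,
        ← TensorProduct.tmul_add, hb, Algebra.algebraMap_eq_smul_one, TensorProduct.tmul_smul,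
        Algebra.TensorProduct.one_def]
    have e2 := congrArg (fun x => (ω x).re) e
    simp only [map_add, map_smul, Complex.add_re, smul_eq_mul, Complex.re_ofReal_mul] at e2
    linarith
  induction t with
  | zero => exact ⟨0, le_rfl, fun ω _ => by simp⟩
  | tmul a b =>
    refine ⟨‖a‖ * ‖b‖, by positivity, fun ω hω => ?_⟩
    obtain ⟨ω', hω', he⟩ := vectorFunctionals_conj ω hω ((1 : A) ⊗ₜ[ℂ] b)
    have e1 : ω (star (a ⊗ₜ[ℂ] b) * (a ⊗ₜ[ℂ] b))
        = ω' (star (a ⊗ₜ[ℂ] (1 : B)) * (a ⊗ₜ[ℂ] (1 : B))) := by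
      rw [he]
      simp
    have h1 := hl a ω' hω'
    have h2 := hr b ω hω
    rw [he 1, mul_one] at h1
    rw [e1]
    have := sq_nonneg ‖a‖
    nlinarith
  | add s t hs ht =>
    obtain ⟨c, hc, hs⟩ := hs
    obtain ⟨d, hd, ht⟩ := ht
    refine ⟨2 * (c + d), by positivity, fun ω hω => ?_⟩
    have h1 := hs ω hω
    have h2 := ht ω hω
    have h3 := vectorFunctionals_pos ω hω (s - t)
    have h4 := vectorFunctionals_pos ω hω 1
    have e1 : star (s + t) * (s + t) + star (s - t) * (s - t)
        = (star s * s + star s * s) + (star t * t + star t * t) := by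
      rw [star_add, star_sub]; noncomm_ring
    have e2 := congrArg (fun x => (ω x).re) e1
    simp only [map_add, Complex.add_re] at e2
    rw [star_one, one_mul] at h4
    nlinarith [mul_nonneg (mul_nonneg hc hd) h4, mul_nonneg (mul_nonneg hc hc) h4,
      mul_nonneg (mul_nonneg hd hd) h4]

/-- The minimal (spatial) C*-seminorm on the algebraic tensor product of two C*-algebras:
the supremum of `‖(π ⊗ ρ)(t)‖` over all *-representations `π` of `A` and `ρ` of `B` on Hilbert
spaces, where `‖(π ⊗ ρ)(t)‖` is expressed as the least `c ≥ 0` with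
`‖(π ⊗ ρ)(t) ζ‖² ≤ c² ‖ζ‖²` for all `ζ`. -/
noncomputable def minSeminorm (A B : Type*) [CStarAlgebra A] [CStarAlgebra B] :
    CStarSeminorm (A ⊗[ℂ] B) :=
  CStarSeminorm.ofFunctionals (vectorFunctionals A B) vectorFunctionals_pos vectorFunctionals_conj
    vectorFunctionals_bdd

/-- The minimal (spatial) C*-tensor product of two C*-algebras. -/
abbrev MinTensor (A B : Type*) [CStarAlgebra A] [CStarAlgebra B] : Type _ :=
  (minSeminorm A B).Completion

namespace MinTensor

/-- The canonical *-homomorphism of the algebraic to the minimal tensor product. -/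
noncomputable def of (A B : Type*) [CStarAlgebra A] [CStarAlgebra B] :
    A ⊗[ℂ] B →⋆ₐ[ℂ] MinTensor A B := (minSeminorm A B).of

/-- The elementary tensor `a ⊗ b`. -/
noncomputable def tmul (a : A) (b : B) : MinTensor A B := of A B (a ⊗ₜ[ℂ] b)

/-- The algebraic tensor product of two *-homomorphisms. -/
noncomputable def algMap (f : A →⋆ₐ[ℂ] C) (g : B →⋆ₐ[ℂ] D) : A ⊗[ℂ] B →⋆ₐ[ℂ] C ⊗[ℂ] D where
  __ := Algebra.TensorProduct.map f.toAlgHom g.toAlgHom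
  map_star' t := by
    change Algebra.TensorProduct.map f.toAlgHom g.toAlgHom (star t) =
      star (Algebra.TensorProduct.map f.toAlgHom g.toAlgHom t)
    induction t with
    | zero => simp
    | add s t hs ht => rw [star_add, map_add, hs, ht, map_add, star_add]
    | tmul a b => simp [StarHomClass.map_star]

theorem algMap_tmul (f : A →⋆ₐ[ℂ] C) (g : B →⋆ₐ[ℂ] D) (a : A) (b : B) :
    algMap f g (a ⊗ₜ[ℂ] b) = f a ⊗ₜ[ℂ] g b := rfl

theorem minSeminorm_algMap_le (f : A →⋆ₐ[ℂ] C) (g : B →⋆ₐ[ℂ] D) (t : A ⊗[ℂ] B) :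
    minSeminorm C D (algMap f g t) ≤ minSeminorm A B t := by
  refine csInf_le_csInf ⟨0, fun c hc => hc.1⟩ (vectorFunctionals_bdd t) fun c hc => ⟨hc.1, ?_⟩
  rintro ω ⟨ι, _, φ, ψ, rfl⟩
  have e : ∀ x, φ.prod ψ (algMap f g x) = (φ.comp f).prod (ψ.comp g) x := by
    intro x
    induction x with
    | zero => simp
    | add s t hs ht => simp only [map_add, hs, ht]
    | tmul a b => rw [algMap_tmul, PosKernel.prod_tmul, PosKernel.prod_tmul]; rfl
  have h := hc.2 _ ⟨ι, inferInstance, φ.comp f, ψ.comp g, rfl⟩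
  rw [← e, ← e, map_mul, map_star, map_one] at h
  exact h

/-- The tensor product `f ⊗ g` of two *-homomorphisms, on the minimal tensor products. -/
noncomputable def map (f : A →⋆ₐ[ℂ] C) (g : B →⋆ₐ[ℂ] D) :
    MinTensor A B →⋆ₐ[ℂ] MinTensor C D :=
  (minSeminorm A B).lift ((of C D).comp (algMap f g)) fun t =>
    ((minSeminorm C D).norm_of (algMap f g t)).le.trans (minSeminorm_algMap_le f g t)

theorem map_tmul (f : A →⋆ₐ[ℂ] C) (g : B →⋆ₐ[ℂ] D) (a : A) (b : B) :
    map f g (tmul a b) = tmul (f a) (g b) :=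
  (minSeminorm A B).lift_of _ _ (a ⊗ₜ[ℂ] b)

end MinTensor

end MinTensor

/-! ### Universal C*-algebras given by generators and relations -/

/-- The free unital *-algebra over `ℂ` on a set `X`: the algebra of noncommutative polynomials in the
symbols `x` (encoded as `(x, false)`) and `x*` (encoded as `(x, true)`). -/
def FreeStarAlgebra (X : Type*) : Type _ := FreeAlgebra ℂ (X × Bool)

namespace FreeStarAlgebra

variable {X : Type*}

noncomputable instance : Ring (FreeStarAlgebra X) := inferInstanceAs (Ring (FreeAlgebra ℂ (X × Bool)))
noncomputable instance : Algebra ℂ (FreeStarAlgebra X) :=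
  inferInstanceAs (Algebra ℂ (FreeAlgebra ℂ (X × Bool)))

/-- The symbols `x` and `x*`. -/
noncomputable def letter (y : X × Bool) : FreeStarAlgebra X := FreeAlgebra.ι ℂ y

/-- The generator `x`. -/
noncomputable def gen (x : X) : FreeStarAlgebra X := letter (x, false)

/-- The opposite algebra of the free *-algebra, with the conjugate scalar multiplication. -/
def ConjOp (X : Type*) : Type _ := (FreeStarAlgebra X)ᵐᵒᵖ

noncomputable instance : Ring (ConjOp X) := inferInstanceAs (Ring (FreeStarAlgebra X)ᵐᵒᵖ)
/-- The scalars of the conjugate opposite algebra. -/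
noncomputable def conjScalar : ℂ →+* (FreeStarAlgebra X)ᵐᵒᵖ :=
  (algebraMap ℂ (FreeStarAlgebra X)ᵐᵒᵖ).comp (starRingEnd ℂ)

theorem conjScalar_commutes (c : ℂ) (x : (FreeStarAlgebra X)ᵐᵒᵖ) :
    conjScalar c * x = x * conjScalar c :=
  Algebra.commutes (A := (FreeStarAlgebra X)ᵐᵒᵖ) (starRingEnd ℂ c) x

noncomputable instance : Algebra ℂ (ConjOp X) :=
  RingHom.toAlgebra' (S := ConjOp X) conjScalar conjScalar_commutes

/-- The involution, as a homomorphism to the conjugate opposite algebra. -/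
noncomputable def starHom : FreeStarAlgebra X →ₐ[ℂ] ConjOp X :=
  FreeAlgebra.lift ℂ fun y => (MulOpposite.op (letter (y.1, !y.2)) : (FreeStarAlgebra X)ᵐᵒᵖ)

noncomputable instance : Star (FreeStarAlgebra X) where
  star a := MulOpposite.unop (α := FreeStarAlgebra X) (starHom a)

theorem star_letter (y : X × Bool) : star (letter y) = letter (y.1, !y.2) :=
  congrArg (MulOpposite.unop (α := FreeStarAlgebra X)) (FreeAlgebra.lift_ι_apply (A := ConjOp X) _ _)

theorem star_add_free (a b : FreeStarAlgebra X) : star (a + b) = star a + star b :=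
  congrArg (MulOpposite.unop (α := FreeStarAlgebra X)) (map_add starHom a b)

theorem star_mul_free (a b : FreeStarAlgebra X) : star (a * b) = star b * star a :=
  congrArg (MulOpposite.unop (α := FreeStarAlgebra X)) (map_mul starHom a b)

theorem star_algebraMap_free (c : ℂ) :
    star (algebraMap ℂ (FreeStarAlgebra X) c) = algebraMap ℂ (FreeStarAlgebra X) (star c) :=
  congrArg (MulOpposite.unop (α := FreeStarAlgebra X)) (AlgHom.commutes starHom c)

theorem induction {P : FreeStarAlgebra X → Prop}
    (h0 : ∀ c : ℂ, P (algebraMap ℂ _ c)) (h1 : ∀ y, P (letter y))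
    (h2 : ∀ a b, P a → P b → P (a * b)) (h3 : ∀ a b, P a → P b → P (a + b))
    (a : FreeStarAlgebra X) : P a :=
  FreeAlgebra.induction ℂ (X × Bool) (motive := P) h0 h1 h2 h3 a

noncomputable instance : StarRing (FreeStarAlgebra X) where
  star_involutive a := by
    induction a using induction with
    | h0 c => rw [star_algebraMap_free, star_algebraMap_free, star_star]
    | h1 y => rw [star_letter, star_letter, Bool.not_not]
    | h2 a b ha hb => rw [star_mul_free, star_mul_free, ha, hb]
    | h3 a b ha hb => rw [star_add_free, star_add_free, ha, hb]
  star_mul := star_mul_free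
  star_add := star_add_free

instance : StarModule ℂ (FreeStarAlgebra X) where
  star_smul c a := by
    rw [Algebra.smul_def, star_mul, star_algebraMap_free, Algebra.smul_def, Algebra.commutes]

end FreeStarAlgebra

section Universal

variable {X : Type*}

/-- The C*-seminorms on the free *-algebra for which the relations `r = 0`, `r ∈ R`, hold. -/
def relSeminorms (R : Set (FreeStarAlgebra X)) : Set (CStarSeminorm (FreeStarAlgebra X)) :=
  {q | ∀ r ∈ R, q r = 0}

/-- The relations bound the generators, so that the universal C*-algebra exists. -/
def IsBoundedRel (R : Set (FreeStarAlgebra X)) : Prop :=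
  ∀ x : X, ∃ c : ℝ, ∀ q ∈ relSeminorms R, q (FreeStarAlgebra.gen x) ≤ c

theorem CStarSeminorm.one_le {E : Type*} [Ring E] [StarRing E] [Algebra ℂ E] (q : CStarSeminorm E) :
    q 1 ≤ 1 := by
  have h := q.star_mul_self' 1
  rw [star_one, one_mul] at h
  nlinarith

theorem relSeminorms_bdd {R : Set (FreeStarAlgebra X)} (hR : IsBoundedRel R)
    (a : FreeStarAlgebra X) : ∃ c : ℝ, 0 ≤ c ∧ ∀ q ∈ relSeminorms R, q a ≤ c := by
  induction a using FreeStarAlgebra.induction with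
  | h0 c =>
    refine ⟨‖c‖, norm_nonneg c, fun q _ => ?_⟩
    rw [Algebra.algebraMap_eq_smul_one]
    refine (q.smul' c 1).le.trans ?_
    have := q.one_le
    have := norm_nonneg c
    exact mul_le_of_le_one_right (norm_nonneg c) q.one_le
  | h1 y =>
    obtain ⟨x, s⟩ := y
    obtain ⟨c, hc⟩ := hR x
    refine ⟨max c 0, le_max_right _ _, fun q hq => le_max_of_le_left ?_⟩
    cases s with
    | false => exact hc q hq
    | true =>
      have h := q.star_eq (FreeStarAlgebra.gen x)
      rw [FreeStarAlgebra.gen, FreeStarAlgebra.star_letter] at h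
      exact h.le.trans (hc q hq)
  | h2 a b ha hb =>
    obtain ⟨c, hc, ha⟩ := ha
    obtain ⟨d, hd, hb⟩ := hb
    exact ⟨c * d, mul_nonneg hc hd, fun q hq => (q.mul_le' a b).trans
      (mul_le_mul (ha q hq) (hb q hq) (q.nonneg b) hc)⟩
  | h3 a b ha hb =>
    obtain ⟨c, hc, ha⟩ := ha
    obtain ⟨d, hd, hb⟩ := hb
    exact ⟨c + d, add_nonneg hc hd, fun q hq => (q.add_le' a b).trans
      (add_le_add (ha q hq) (hb q hq))⟩

/-- The zero C*-seminorm. -/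
noncomputable def CStarSeminorm.zero (E : Type*) [Ring E] [StarRing E] [Algebra ℂ E] :
    CStarSeminorm E :=
  { (0 : Seminorm ℂ E) with
    mul_le' := fun _ _ => (mul_zero (0 : ℝ)).ge
    star_mul_self' := fun _ => (zero_pow two_ne_zero).symm }

/-- The greatest C*-seminorm on the free *-algebra for which the relations `R` hold. -/
noncomputable def universalSeminorm (R : Set (FreeStarAlgebra X)) (hR : IsBoundedRel R) :
    CStarSeminorm (FreeStarAlgebra X) :=
  let N : FreeStarAlgebra X → ℝ := fun a => ⨆ q : relSeminorms R, q.1 a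
  have hne : Nonempty (relSeminorms R) := ⟨⟨CStarSeminorm.zero _, fun _ _ => rfl⟩⟩
  have hbdd : ∀ a, BddAbove (Set.range fun q : relSeminorms R => q.1 a) := fun a => by
    obtain ⟨c, -, hc⟩ := relSeminorms_bdd hR a
    exact ⟨c, by rintro _ ⟨q, rfl⟩; exact hc q.1 q.2⟩
  have hle : ∀ (q : relSeminorms R) a, q.1 a ≤ N a := fun q a => le_ciSup (hbdd a) q
  have h0 : ∀ a, 0 ≤ N a := fun a => (hne.some.1.nonneg a).trans (hle _ a)
  { Seminorm.ofSMulLE N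
      (le_antisymm (ciSup_le fun q => (map_zero q.1.toSeminorm).le) (h0 0))
      (fun a b => ciSup_le fun q => (q.1.add_le' a b).trans (add_le_add (hle q a) (hle q b)))
      (fun c a => ciSup_le fun q => (q.1.smul' c a).le.trans
        (mul_le_mul_of_nonneg_left (hle q a) (norm_nonneg c))) with
    mul_le' := fun a b => ciSup_le fun q => (q.1.mul_le' a b).trans
      (mul_le_mul (hle q a) (hle q b) (q.1.nonneg b) (h0 a))
    star_mul_self' := fun a => le_antisymm
      (ciSup_le fun q => (q.1.star_mul_self' a).le.trans
        (pow_le_pow_left₀ (q.1.nonneg a) (hle q a) 2))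
      (by
        have h : N a ≤ Real.sqrt (N (star a * a)) := ciSup_le fun q =>
          Real.le_sqrt_of_sq_le ((q.1.star_mul_self' a).ge.trans (hle q _))
        calc N a ^ 2 ≤ Real.sqrt (N (star a * a)) ^ 2 := pow_le_pow_left₀ (h0 a) h 2
          _ = N (star a * a) := Real.sq_sqrt (h0 _)) }

/-- The universal C*-algebra with generators `X` and relations `r = 0`, `r ∈ R`. -/
abbrev UniversalCStarAlgebra (R : Set (FreeStarAlgebra X)) (hR : IsBoundedRel R) : Type _ :=
  (universalSeminorm R hR).Completion

end Universal

/-! ### Compact quantum groups and their actions -/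

/-- The structure of a Hopf *-algebra on a unital *-algebra `P` over `ℂ`. -/
structure HopfStarStructure (P : Type*) [Ring P] [StarRing P] [Algebra ℂ P] [StarModule ℂ P] where
  comul : P →⋆ₐ[ℂ] P ⊗[ℂ] P
  counit : P →⋆ₐ[ℂ] ℂ
  antipode : P →ₗ[ℂ] P
  coassoc : TensorProduct.assoc ℂ P P P ∘ₗ comul.toAlgHom.toLinearMap.rTensor P ∘ₗ
    comul.toAlgHom.toLinearMap =
      comul.toAlgHom.toLinearMap.lTensor P ∘ₗ comul.toAlgHom.toLinearMap
  rTensor_counit_comp_comul : counit.toAlgHom.toLinearMap.rTensor P ∘ₗ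
    comul.toAlgHom.toLinearMap = TensorProduct.mk ℂ ℂ P 1
  lTensor_counit_comp_comul : counit.toAlgHom.toLinearMap.lTensor P ∘ₗ
    comul.toAlgHom.toLinearMap = (TensorProduct.mk ℂ P ℂ).flip 1
  mul_antipode_rTensor_comul : LinearMap.mul' ℂ P ∘ₗ antipode.rTensor P ∘ₗ
    comul.toAlgHom.toLinearMap = Algebra.linearMap ℂ P ∘ₗ counit.toAlgHom.toLinearMap
  mul_antipode_lTensor_comul : LinearMap.mul' ℂ P ∘ₗ antipode.lTensor P ∘ₗ
    comul.toAlgHom.toLinearMap = Algebra.linearMap ℂ P ∘ₗ counit.toAlgHom.toLinearMap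

/-- The structure of a compact quantum group (of a full Woronowicz Hopf C*-algebra) on a unital
C*-algebra `A`: a coproduct `A → A ⊗ A` that restricts on a dense unital *-subalgebra to the
comultiplication of a Hopf *-algebra, such that the norm of `A` restricts to the greatest C*-seminorm
of that Hopf *-algebra.

The coproduct is coassociative on `A`, since it is so on the dense subalgebra. The dense Hopf
*-subalgebra is determined by the coproduct: it is the algebra of all coefficients of
finite-dimensional unitary representations of the quantum group. -/
structure CompactQuantumGroup (A : Type*) [CStarAlgebra A] where
  comul : A →⋆ₐ[ℂ] MinTensor A A
  core : StarSubalgebra ℂ A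
  dense_core : Dense (core : Set A)
  hopf : HopfStarStructure core
  comul_core : ∀ a : core, comul a =
    MinTensor.of A A (Algebra.TensorProduct.map core.subtype.toAlgHom core.subtype.toAlgHom
      (hopf.comul a))
  full : ∀ (q : CStarSeminorm core) (a : core), q a ≤ ‖(a : A)‖

namespace CompactQuantumGroup

variable {A A' B : Type*} [CStarAlgebra A] [CStarAlgebra A'] [CStarAlgebra B]

/-- The quantum group is of Kac type: its antipode is a bounded *-antihomomorphism. -/
def IsKac (G : CompactQuantumGroup A) : Prop :=
  (∀ a b, G.hopf.antipode (a * b) = G.hopf.antipode b * G.hopf.antipode a) ∧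
  (∀ a, G.hopf.antipode (star a) = star (G.hopf.antipode a)) ∧
  ∃ c : ℝ, ∀ a, ‖G.hopf.antipode a‖ ≤ c * ‖a‖

/-- `α : B → B ⊗ A` is an action of the compact quantum group on the C*-algebra `B`: on some dense
unital *-subalgebra of `B` it restricts to a coaction of the dense Hopf *-subalgebra of `A`.

By continuity, the coaction identities `(id ⊗ Φ) α = (α ⊗ id) α` and `(id ⊗ ε) α = id` then hold on
all of `B`. -/
def IsAction (G : CompactQuantumGroup A) (α : B →⋆ₐ[ℂ] MinTensor B A) : Prop :=
  ∃ B₀ : StarSubalgebra ℂ B, Dense (B₀ : Set B) ∧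
    ∃ ρ : B₀ →ₗ[ℂ] B₀ ⊗[ℂ] G.core,
      (∀ b : B₀, α b = MinTensor.of B A
        (Algebra.TensorProduct.map B₀.subtype.toAlgHom G.core.subtype.toAlgHom (ρ b))) ∧
      TensorProduct.assoc ℂ B₀ G.core G.core ∘ₗ ρ.rTensor G.core ∘ₗ ρ =
        G.hopf.comul.toAlgHom.toLinearMap.lTensor B₀ ∘ₗ ρ ∧
      G.hopf.counit.toAlgHom.toLinearMap.lTensor B₀ ∘ₗ ρ = (TensorProduct.mk ℂ B₀ ℂ).flip 1

/-- The functional `φ` is invariant under `α`: `(φ ⊗ id) α b = φ b • 1`, where `φ ⊗ id` is the slice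
map, the unique continuous linear map with `b ⊗ a ↦ φ b • a`. -/
def Invariant (φ : B →L[ℂ] ℂ) (α : B →⋆ₐ[ℂ] MinTensor B A) : Prop :=
  ∃ S : MinTensor B A →L[ℂ] A, (∀ b a, S (MinTensor.tmul b a) = φ b • a) ∧
    ∀ b, S (α b) = φ b • (1 : A)

/-- `(G, α)` is a quantum transformation group of the pair `(B, φ)`. -/
def IsTransformationGroup (φ : B →L[ℂ] ℂ) (G : CompactQuantumGroup A)
    (α : B →⋆ₐ[ℂ] MinTensor B A) : Prop :=
  G.IsAction α ∧ Invariant φ α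

/-- `π` is a morphism of quantum transformation groups from `(G', α')` to `(G, α)`: a morphism of
Woronowicz Hopf C*-algebras from `A` to `A'` with `α' = (id ⊗ π) α`. -/
def IsMorphism (G' : CompactQuantumGroup A') (α' : B →⋆ₐ[ℂ] MinTensor B A')
    (G : CompactQuantumGroup A) (α : B →⋆ₐ[ℂ] MinTensor B A) (π : A →⋆ₐ[ℂ] A') : Prop :=
  (∀ a, G'.comul (π a) = MinTensor.map π π (G.comul a)) ∧
    ∀ b, α' b = MinTensor.map (StarAlgHom.id ℂ B) π (α b)

end CompactQuantumGroup

open CompactQuantumGroup in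
/-- `(G, α)` is the quantum automorphism group of the pair `(B, φ)`: a final object in the category of
compact quantum transformation groups of `(B, φ)`. -/
def IsQuantumAutomorphismGroup.{w, u, v} {A : Type u} {B : Type v} [CStarAlgebra A] [CStarAlgebra B]
    (φ : B →L[ℂ] ℂ) (G : CompactQuantumGroup A) (α : B →⋆ₐ[ℂ] MinTensor B A) : Prop :=
  IsTransformationGroup φ G α ∧
    ∀ (A' : Type w) [CStarAlgebra A'] (G' : CompactQuantumGroup A')
      (α' : B →⋆ₐ[ℂ] MinTensor B A'), IsTransformationGroup φ G' α' →
        ∃! π : A →⋆ₐ[ℂ] A', IsMorphism G' α' G α π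

open CompactQuantumGroup in
/-- `(G, α)` is the quantum automorphism group of the pair `(B, φ)` in the category of compact quantum
transformation groups of Kac type of `(B, φ)`. -/
def IsKacQuantumAutomorphismGroup.{w, u, v} {A : Type u} {B : Type v} [CStarAlgebra A]
    [CStarAlgebra B] (φ : B →L[ℂ] ℂ) (G : CompactQuantumGroup A)
    (α : B →⋆ₐ[ℂ] MinTensor B A) : Prop :=
  (G.IsKac ∧ IsTransformationGroup φ G α) ∧
    ∀ (A' : Type w) [CStarAlgebra A'] (G' : CompactQuantumGroup A')
      (α' : B →⋆ₐ[ℂ] MinTensor B A'), G'.IsKac → IsTransformationGroup φ G' α' →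
        ∃! π : A →⋆ₐ[ℂ] A', IsMorphism G' α' G α π

/-- The group `Aut B` of *-automorphisms of a C*-algebra carries the topology of pointwise norm
convergence. -/
instance autTopology (B : Type*) [CStarAlgebra B] : TopologicalSpace (B ≃⋆ₐ[ℂ] B) :=
  TopologicalSpace.induced (fun g (b : B) => g b) inferInstance

/-- The quantum transformation group `(G, α)` of `B` contains the ordinary transformation group
`Aut B`, and `Aut B` is its maximal classical subgroup: there is a surjective morphism
`r : A → C(Aut B)` of Woronowicz Hopf C*-algebras through which `α` induces the usual action of
`Aut B` on `B`, and every character of `A` is the evaluation at one and only one point of `Aut B`. -/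
def ContainsAut {A B : Type*} [CStarAlgebra A] [CStarAlgebra B] (G : CompactQuantumGroup A)
    (α : B →⋆ₐ[ℂ] MinTensor B A) : Prop :=
  ∃ r : A →⋆ₐ[ℂ] C(B ≃⋆ₐ[ℂ] B, ℂ), Function.Surjective r ∧
    (∀ g h a, MinTensor.map ((ContinuousMap.evalStarAlgHom ℂ ℂ g).comp r)
      ((ContinuousMap.evalStarAlgHom ℂ ℂ h).comp r) (G.comul a) = r a (g * h) • 1) ∧
    (∀ g b, MinTensor.map (StarAlgHom.id ℂ B) ((ContinuousMap.evalStarAlgHom ℂ ℂ g).comp r) (α b)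
      = MinTensor.tmul (g b) 1) ∧
    Function.Bijective fun g : B ≃⋆ₐ[ℂ] B => (ContinuousMap.evalStarAlgHom ℂ ℂ g).comp r

/-! ### The quantum automorphism group of the matrix algebra -/

/-- The C*-algebra of complex `n × n` matrices. -/
abbrev MatAlg (n : ℕ) : Type := CStarMatrix (Fin n) (Fin n) ℂ

/-- The matrix unit `e_ij`. -/
def matUnit {n : ℕ} (i j : Fin n) : MatAlg n := CStarMatrix.ofMatrix (Matrix.single i j 1)

/-- The trace functional. -/
noncomputable def matTrace (n : ℕ) : MatAlg n →L[ℂ] ℂ where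
  toFun x := ∑ i, x i i
  map_add' x y := Finset.sum_add_distrib
  map_smul' c x := by simp [Finset.mul_sum]
  cont := continuous_finsetSum _ fun i _ =>
    (continuous_apply i).comp (continuous_apply i)

/-- The symbol `a k l i j` for the generator with upper indices `k l` and lower indices `i j`. -/
noncomputable def symb {n : ℕ} (k l i j : Fin n) :
    FreeStarAlgebra (Fin n × Fin n × Fin n × Fin n) := FreeStarAlgebra.gen (k, l, i, j)

/-- The defining relations, each written as a difference that is to vanish. -/
inductive AutRel (n : ℕ) : FreeStarAlgebra (Fin n × Fin n × Fin n × Fin n) → Prop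
  | mul (i j k l r s : Fin n) : AutRel n
      (∑ v, symb k v i j * symb v l r s - if j = r then symb k l i s else 0)
  | mul' (i j k l r s : Fin n) : AutRel n
      (∑ v, symb s r l v * symb j i v k - if j = r then symb s i l k else 0)
  | adj (i j k l : Fin n) : AutRel n (star (symb k l i j) - symb l k j i)
  | unit (k l : Fin n) : AutRel n (∑ r, symb k l r r - if k = l then 1 else 0)
  | trace (k l : Fin n) : AutRel n (∑ r, symb r r k l - if k = l then 1 else 0)

theorem autRel_bounded (n : ℕ) : IsBoundedRel {x | AutRel n x} := by
  rintro ⟨k, l, i, j⟩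
  refine ⟨1, fun q hq => ?_⟩
  have hz : ∀ x, AutRel n x → q.of x = 0 := fun x hx => by
    rw [← norm_eq_zero, q.norm_of]; exact hq x hx
  set a : Fin n → Fin n → Fin n → Fin n → q.Completion := fun k l i j => q.of (symb k l i j) with ha
  have hstar : ∀ k l i j, star (a k l i j) = a l k j i := fun k l i j => by
    have := hz _ (AutRel.adj i j k l)
    rw [map_sub, map_star, sub_eq_zero] at this
    exact this
  have hmul : ∀ l, ∑ v, a l v j i * a v l i j = a l l j j := fun l => by
    have := hz _ (AutRel.mul j i l l i j)
    rw [map_sub, if_pos rfl, map_sum, sub_eq_zero] at this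
    simpa only [map_mul] using this
  have htr : ∑ r, a r r j j = 1 := by
    have := hz _ (AutRel.trace j j)
    rwa [map_sub, if_pos rfl, map_sum, map_one, sub_eq_zero] at this
  have hsum : ∑ l, ∑ v, star (a v l i j) * a v l i j = 1 := by
    simp only [hstar, hmul, htr]
  let _ := CStarAlgebra.spectralOrder q.Completion
  have _ := CStarAlgebra.spectralOrderedRing q.Completion
  have hle : star (a k l i j) * a k l i j ≤ 1 := by
    rw [← hsum]
    refine (Finset.single_le_sum (f := fun v => star (a v l i j) * a v l i j)
      (fun v _ => star_mul_self_nonneg _) (Finset.mem_univ k)).trans ?_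
    exact Finset.single_le_sum (f := fun l => ∑ v, star (a v l i j) * a v l i j)
      (fun l _ => Finset.sum_nonneg fun v _ => star_mul_self_nonneg _) (Finset.mem_univ l)
  have h1 := (CStarAlgebra.norm_le_one_iff_of_nonneg _ (star_mul_self_nonneg (a k l i j))).2 hle
  rw [CStarRing.norm_star_mul_self] at h1
  have h2 : ‖a k l i j‖ = q (symb k l i j) := q.norm_of _
  change q (symb k l i j) ≤ 1
  rw [← h2]
  nlinarith [norm_nonneg (a k l i j)]

/-- The universal C*-algebra with generators `a k l i j` and the relations above. -/
abbrev Aaut (n : ℕ) : Type := UniversalCStarAlgebra {x | AutRel n x} (autRel_bounded n)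

/-- The generator of the universal C*-algebra with upper indices `k l` and lower indices `i j`. -/
noncomputable def agen {n : ℕ} (k l i j : Fin n) : Aaut n :=
  (universalSeminorm {x | AutRel n x} (autRel_bounded n)).of (symb k l i j)

universe w

/-!
The defining relations of `Aaut n` say that the matrix `a = (a k l i j)`, with rows indexed by the
pairs `(k, l)` and columns by the pairs `(i, j)`, defines a unital *-homomorphism
`e_ij ↦ ∑ e_kl ⊗ a k l i j` that preserves the trace, together with a second multiplication rule.
A family that satisfies them is an `IsAutFamily`. All the structure comes from the universal
property and the permanence properties of such families: the matrix product of two commuting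
families (`IsAutFamily.autMul`) gives the coproduct, the identity matrix (`isAutFamily_one`) the
counit, and the passage to `a⁻¹ = a*` in the opposite algebra (`IsAutFamily.op`) the antipode, which
is therefore a contractive *-antihomomorphism.

The dense Hopf *-algebra is the *-subalgebra generated by the entries of `a`. Its norm is the greatest
C*-seminorm because any C*-seminorm on it satisfies the relations. The comultiplication restricts to
it because the algebraic tensor product embeds into the minimal one (`MinTensor.of_injective`). This
rests on two facts: positive functionals separate the points of a C*-algebra, by Hahn-Banach
separation from the positive cone, and slice maps by positive functionals are bounded for the minimal
norm, by the Cauchy-Schwarz inequality. The same slice maps express the invariance of the trace.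

For the universal property, let `u` be the matrix of coefficients of an action that preserves the
trace. The first multiplication rule and the trace condition give `u* u = 1`, while the antipode
gives a right inverse. So `u` is invertible with inverse `u*`, and the second multiplication rule
follows by inverting the first (`IsAutFamily.of_rightInverse`). No condition on the antipode is used,
so that the same argument serves all compact quantum groups and those of Kac type.

Scalar families are the same as *-automorphisms of the matrix algebra: an automorphism preserves the
trace since the trace is unique, and a scalar family defines an injective endomorphism since the
matrix algebra is simple. The coefficient functions on the compact group of automorphisms form a
family, which gives the restriction map `Aaut.restrictHom`. It has dense range by the
Stone-Weierstrass theorem, and a *-homomorphism of C*-algebras with dense range is surjective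
(`surjective_of_denseRange`).
-/

/-! ### Positive functionals and slice maps -/

section PositiveFunctional

variable {A B : Type*} [CStarAlgebra A] [CStarAlgebra B]

/-- A self-adjoint element that is not positive takes a negative value at some positive functional:
separate it from the closed cone of positive elements by a real functional, and extend that
functional from the self-adjoint part to a complex functional. -/
theorem exists_posFunctional_re_lt_zero (a : A) (hs : IsSelfAdjoint a)
    (ha : ∀ b : A, a ≠ star b * b) :
    ∃ φ : A →ₗ[ℂ] ℂ, (∀ x, 0 ≤ φ (star x * x)) ∧ (φ a).re < 0 := by
  let _ := CStarAlgebra.spectralOrder A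
  have _ := CStarAlgebra.spectralOrderedRing A
  let K : ProperCone ℝ A :=
    { carrier := {x | 0 ≤ x}
      add_mem' := fun hx hy => by
        rw [Set.mem_ofPred_eq] at hx hy ⊢
        exact add_nonneg hx hy
      zero_mem' := le_refl (0 : A)
      smul_mem' := fun c x hx => by
        rw [Set.mem_ofPred_eq] at hx ⊢
        exact smul_nonneg c.2 hx
      isClosed' := CStarAlgebra.isClosed_nonneg }
  have haK : a ∉ K := fun h => by
    obtain ⟨b, hb⟩ := CStarAlgebra.nonneg_iff_eq_star_mul_self.1 (show 0 ≤ a from h)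
    exact ha b hb
  obtain ⟨f, hf, hfa⟩ := K.hyperplane_separation_point haK
  let g : A →ₗ[ℝ] ℝ := f.toLinearMap ∘ₗ (selfAdjoint.submodule ℝ A).subtype ∘ₗ realPart
  have hg : ∀ x : A, IsSelfAdjoint x → g x = f x := fun x hx => by
    change f (realPart x : A) = f x
    rw [hx.coe_realPart]
  have hgI : ∀ x : A, IsSelfAdjoint x → g (Complex.I • x) = 0 := fun x hx => by
    change f (realPart (Complex.I • x) : A) = 0
    rw [realPart_I_smul, hx.imaginaryPart]
    simp
  let φ : A →ₗ[ℂ] ℂ := Module.Dual.extendRCLike (𝕜 := ℂ) g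
  have hφ : ∀ x : A, IsSelfAdjoint x → φ x = f x := fun x hx => by
    change Module.Dual.extendRCLike (𝕜 := ℂ) g x = f x
    rw [Module.Dual.extendRCLike_apply]
    simp [hg x hx, hgI x hx]
  refine ⟨φ, fun x => ?_, ?_⟩
  · rw [hφ _ (.star_mul_self x)]
    exact Complex.zero_le_real.2 (hf _ (star_mul_self_nonneg x))
  · rw [hφ a hs]; exact hfa

/-- Positive functionals on a *-algebra are hermitian. -/
theorem conj_of_nonneg {E : Type*} [Ring E] [StarRing E] [Algebra ℂ E] [StarModule ℂ E]
    (ω : E →ₗ[ℂ] ℂ) (hω : ∀ x, 0 ≤ ω (star x * x)) (x y : E) :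
    ω (star x * y) = starRingEnd ℂ (ω (star y * x)) := by
  have h1 := (Complex.nonneg_iff.1 (hω (x + y))).2
  have h2 := (Complex.nonneg_iff.1 (hω (x + Complex.I • y))).2
  have hx := (Complex.nonneg_iff.1 (hω x)).2
  have hy := (Complex.nonneg_iff.1 (hω y)).2
  simp only [star_add, star_smul, add_mul, mul_add, map_add, map_smul, smul_mul_assoc,
    mul_smul_comm, smul_eq_mul, Complex.add_im, Complex.star_def, Complex.conj_I] at h1 h2
  simp at h2
  refine Complex.ext ?_ ?_
  · simp; linarith
  · simp; linarith

/-- The Cauchy-Schwarz inequality for a positive functional on a *-algebra. -/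
theorem norm_sq_le_of_pos {E : Type*} [Ring E] [StarRing E] [Algebra ℂ E] [StarModule ℂ E]
    (ω : E →ₗ[ℂ] ℂ) (hω : ∀ x, 0 ≤ ω (star x * x)) (x y : E) :
    ‖ω (star x * y)‖ ^ 2 ≤ (ω (star x * x)).re * (ω (star y * y)).re := by
  let c : PreInnerProductSpace.Core ℂ E :=
    { inner := fun x y => ω (star x * y)
      conj_inner_symm := fun x y => (conj_of_nonneg ω hω x y).symm
      re_inner_nonneg := fun x => (Complex.nonneg_iff.1 (hω x)).1
      add_left := fun x y z => by simp [add_mul]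
      smul_left := fun x y r => by simp [star_smul] }
  have h : ‖ω (star x * y)‖ * ‖ω (star y * x)‖ ≤ (ω (star x * x)).re * (ω (star y * y)).re :=
    InnerProductSpace.Core.inner_mul_inner_self_le (c := c) x y
  rw [conj_of_nonneg ω hω y x, RCLike.norm_conj] at h
  rwa [sq]

/-- The positive functionals on a C*-algebra separate points. -/
theorem eq_zero_of_posFunctional (a : A)
    (h : ∀ φ : A →ₗ[ℂ] ℂ, (∀ x, 0 ≤ φ (star x * x)) → φ a = 0) : a = 0 := by
  let _ := CStarAlgebra.spectralOrder A
  have _ := CStarAlgebra.spectralOrderedRing A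
  have key : ∀ b : A, IsSelfAdjoint b →
      (∀ φ : A →ₗ[ℂ] ℂ, (∀ x, 0 ≤ φ (star x * x)) → φ b = 0) → 0 ≤ b := by
    intro b hb hφ
    by_contra hneg
    obtain ⟨φ, hp, hlt⟩ := exists_posFunctional_re_lt_zero b hb fun c hc =>
      hneg (hc ▸ star_mul_self_nonneg c)
    rw [hφ φ hp] at hlt
    simp at hlt
  have key2 : ∀ b : A, IsSelfAdjoint b →
      (∀ φ : A →ₗ[ℂ] ℂ, (∀ x, 0 ≤ φ (star x * x)) → φ b = 0) → b = 0 := fun b hb hφ =>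
    le_antisymm (neg_nonneg.1 (key (-b) hb.neg fun φ hp => by rw [map_neg, hφ φ hp, neg_zero]))
      (key b hb hφ)
  have him : ∀ φ : A →ₗ[ℂ] ℂ, (∀ x, 0 ≤ φ (star x * x)) → ∀ b : A, IsSelfAdjoint b →
      (φ b).im = 0 := fun φ hp b hb => by
    have h1 := conj_of_nonneg φ hp b 1
    rw [star_one, one_mul, mul_one, hb.star_eq] at h1
    exact Complex.conj_eq_iff_im.1 h1.symm
  have hsum := realPart_add_I_smul_imaginaryPart a
  have hre : ∀ φ : A →ₗ[ℂ] ℂ, (∀ x, 0 ≤ φ (star x * x)) →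
      φ (realPart a : A) = 0 ∧ φ (imaginaryPart a : A) = 0 := fun φ hp => by
    have h1 := h φ hp
    rw [← hsum, map_add, map_smul, smul_eq_mul] at h1
    have h2 := him φ hp _ (realPart a).2
    have h3 := him φ hp _ (imaginaryPart a).2
    have h4 := congrArg Complex.re h1
    have h5 := congrArg Complex.im h1
    simp [h2, h3] at h4 h5
    exact ⟨Complex.ext h4 h2, Complex.ext h5 h3⟩
  rw [← hsum, key2 _ (realPart a).2 fun φ hp => (hre φ hp).1,
    key2 _ (imaginaryPart a).2 fun φ hp => (hre φ hp).2, smul_zero, add_zero]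

end PositiveFunctional

/-- The minimal C*-seminorm bounds the vector functionals. -/
theorem re_vectorFunctional_le {A B : Type*} [CStarAlgebra A] [CStarAlgebra B]
    (ω : A ⊗[ℂ] B →ₗ[ℂ] ℂ) (hω : ω ∈ vectorFunctionals A B) (t : A ⊗[ℂ] B) :
    (ω (star t * t)).re ≤ minSeminorm A B t ^ 2 * (ω 1).re := by
  have hne : {c : ℝ | 0 ≤ c ∧ ∀ ω ∈ vectorFunctionals A B,
      (ω (star t * t)).re ≤ c ^ 2 * (ω 1).re}.Nonempty := vectorFunctionals_bdd t
  have h0 : 0 ≤ (ω 1).re := by simpa using vectorFunctionals_pos ω hω 1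
  have hcont : Continuous fun c : ℝ => c ^ 2 * (ω 1).re := by fun_prop
  refine ge_of_tendsto (hcont.tendsto (minSeminorm A B t) |>.mono_left
    (nhdsWithin_le_nhds (s := Set.Ioi (minSeminorm A B t)))) ?_
  filter_upwards [self_mem_nhdsWithin] with c hc
  obtain ⟨d, hd, hdc⟩ := exists_lt_of_csInf_lt hne hc
  have := hd.1
  have := hdc.le
  exact (hd.2 ω hω).trans (by gcongr)

/-- A positive functional, as a positive kernel indexed by a one-point set. -/
def PosKernel.ofFunctional {E : Type*} [Ring E] [StarRing E] [Algebra ℂ E] (φ : E →ₗ[ℂ] ℂ)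
    (hφ : ∀ x, 0 ≤ φ (star x * x)) : PosKernel Unit E where
  fn _ _ := φ
  nonneg' x := by simpa using hφ (x ())

/-- The product of two positive functionals is a vector functional. -/
theorem exists_vectorFunctional {A B : Type*} [CStarAlgebra A] [CStarAlgebra B]
    (φ : A →ₗ[ℂ] ℂ) (hφ : ∀ x, 0 ≤ φ (star x * x)) (ψ : B →ₗ[ℂ] ℂ)
    (hψ : ∀ x, 0 ≤ ψ (star x * x)) :
    ∃ ω ∈ vectorFunctionals A B, (∀ t, 0 ≤ ω (star t * t)) ∧ ∀ a b, ω (a ⊗ₜ b) = φ a * ψ b :=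
  ⟨_, ⟨Unit, inferInstance, .ofFunctional φ hφ, .ofFunctional ψ hψ, rfl⟩,
    fun t => PosKernel.prod_nonneg _ _ t,
    fun a b => by rw [PosKernel.prod_tmul]; simp [PosKernel.ofFunctional]⟩

/-- The slice map `φ ⊗ id` on an algebraic tensor product. -/
noncomputable def algSlice {M N : Type*} [AddCommGroup M] [Module ℂ M] [AddCommGroup N] [Module ℂ N]
    (φ : M →ₗ[ℂ] ℂ) : M ⊗[ℂ] N →ₗ[ℂ] N :=
  (TensorProduct.lid ℂ N).toLinearMap ∘ₗ φ.rTensor N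

@[simp] theorem algSlice_tmul {M N : Type*} [AddCommGroup M] [Module ℂ M] [AddCommGroup N]
    [Module ℂ N] (φ : M →ₗ[ℂ] ℂ) (a : M) (b : N) : algSlice φ (a ⊗ₜ[ℂ] b) = φ a • b := by
  simp [algSlice]

namespace MinTensor

variable {A B : Type*} [CStarAlgebra A] [CStarAlgebra B]

/-- Slice maps by positive functionals are bounded for the minimal C*-seminorm, by the
Cauchy-Schwarz inequality for the functionals `φ ⊗ ψ`. -/
theorem norm_algSlice_le (φ : A →ₗ[ℂ] ℂ) (hφ : ∀ x, 0 ≤ φ (star x * x)) (t : A ⊗[ℂ] B) :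
    ‖algSlice φ t‖ ≤ (φ 1).re * minSeminorm A B t := by
  let _ := CStarAlgebra.spectralOrder B
  have _ := CStarAlgebra.spectralOrderedRing B
  set N := minSeminorm A B t with hN
  set x := algSlice φ t
  have hN0 : 0 ≤ N := (minSeminorm A B).nonneg t
  have h1 : 0 ≤ φ 1 := by simpa using hφ 1
  obtain ⟨h1r, h1i⟩ := Complex.nonneg_iff.1 h1
  have hc : 0 ≤ (φ 1).re * N := mul_nonneg h1r hN0
  set c := (φ 1).re * N with hcdef
  have key : ∀ ψ : B →ₗ[ℂ] ℂ, (∀ y, 0 ≤ ψ (star y * y)) →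
      (ψ (star x * x)).re ≤ c ^ 2 * (ψ 1).re := by
    intro ψ hψ
    obtain ⟨ω, hω, hp, hm⟩ := exists_vectorFunctional φ hφ ψ hψ
    have hψ1 : 0 ≤ (ψ 1).re := by simpa using (Complex.nonneg_iff.1 (hψ 1)).1
    have e1 : ω (star ((1 : A) ⊗ₜ[ℂ] x) * t) = ψ (star x * x) := by
      have : ∀ s : A ⊗[ℂ] B, ω (star ((1 : A) ⊗ₜ[ℂ] x) * s) = ψ (star x * algSlice φ s) := by
        intro s
        induction s with
        | zero => simp
        | add s s' h h' => rw [mul_add, map_add, h, h', map_add, mul_add, map_add]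
        | tmul a b => simp [TensorProduct.star_tmul, hm]
      exact this t
    have e2 : ω (star ((1 : A) ⊗ₜ[ℂ] x) * ((1 : A) ⊗ₜ[ℂ] x)) = φ 1 * ψ (star x * x) := by
      simp [TensorProduct.star_tmul, hm]
    have e3 : ω 1 = φ 1 * ψ 1 := by rw [Algebra.TensorProduct.one_def, hm]
    have cs := norm_sq_le_of_pos ω hp ((1 : A) ⊗ₜ[ℂ] x) t
    have hb := re_vectorFunctional_le ω hω t
    have hpr := (Complex.nonneg_iff.1 (hψ x)).1
    rw [e3] at hb
    have e4 : ‖ψ (star x * x)‖ = (ψ (star x * x)).re := (Complex.re_eq_norm.2 (hψ x)).symm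
    rw [e1, e2, e4, Complex.mul_re, ← h1i, zero_mul, sub_zero] at cs
    rw [Complex.mul_re, ← h1i, zero_mul, sub_zero, ← hN] at hb
    set p := (ψ (star x * x)).re
    rcases hpr.eq_or_lt with h | h
    · rw [← h]; positivity
    · refine le_of_mul_le_mul_left ?_ h
      calc p * p = p ^ 2 := (sq p).symm
        _ ≤ (φ 1).re * p * (ω (star t * t)).re := cs
        _ ≤ (φ 1).re * p * (N ^ 2 * ((φ 1).re * (ψ 1).re)) := by gcongr
        _ = p * (c ^ 2 * (ψ 1).re) := by rw [hcdef]; ring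
  have hle : 0 ≤ ((c ^ 2 : ℝ) : ℂ) • (1 : B) - star x * x := by
    by_contra hneg
    obtain ⟨ψ, hp, hlt⟩ := exists_posFunctional_re_lt_zero
      (((c ^ 2 : ℝ) : ℂ) • (1 : B) - star x * x)
      (by
        refine IsSelfAdjoint.sub ?_ (.star_mul_self x)
        simp [IsSelfAdjoint, star_smul])
      fun b hb => hneg (hb ▸ star_mul_self_nonneg b)
    have := key ψ hp
    rw [map_sub, map_smul, Complex.sub_re, smul_eq_mul, Complex.re_ofReal_mul] at hlt
    linarith
  have h2 : ‖star x * x‖ ≤ c ^ 2 := by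
    rw [CStarAlgebra.norm_le_iff_le_algebraMap _ (sq_nonneg c) (star_mul_self_nonneg x)]
    rw [Algebra.algebraMap_eq_smul_one]
    exact sub_nonneg.1 hle
  rw [CStarRing.norm_star_mul_self, ← sq] at h2
  exact (pow_le_pow_iff_left₀ (norm_nonneg _) hc two_ne_zero).1 h2

/-- The slice map `φ ⊗ id` by a positive functional, on the minimal tensor product. -/
theorem exists_slice (φ : A →ₗ[ℂ] ℂ) (hφ : ∀ x, 0 ≤ φ (star x * x)) :
    ∃ S : MinTensor A B →L[ℂ] B, ∀ t, S (of A B t) = algSlice φ t := by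
  refine ⟨LinearMap.extendOfNorm (algSlice φ) (of A B).toAlgHom.toLinearMap, fun t => ?_⟩
  refine LinearMap.extendOfNorm_eq (e := (of A B).toAlgHom.toLinearMap)
    ((minSeminorm A B).denseRange_of) ⟨(φ 1).re, fun t => ?_⟩ t
  refine (norm_algSlice_le φ hφ t).trans_eq ?_
  congr 1
  exact ((minSeminorm A B).norm_of t).symm

/-- The algebraic tensor product embeds into the minimal tensor product. -/
theorem of_injective : Function.Injective (of A B) := by
  classical
  rw [injective_iff_map_eq_zero]
  intro t ht
  have h : ∀ φ : A →ₗ[ℂ] ℂ, (∀ x, 0 ≤ φ (star x * x)) → algSlice φ t = 0 := fun φ hφ => by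
    obtain ⟨S, hS⟩ := exists_slice (B := B) φ hφ
    rw [← hS, ht, map_zero]
  -- slices by positive functionals vanish, and such functionals separate the coefficients of `t`
  let b := Module.Basis.ofVectorSpace ℂ B
  have h2 : (TensorProduct.equivFinsuppOfBasisRight b) t = 0 := by
    ext i
    refine eq_zero_of_posFunctional _ fun φ hφ => ?_
    have h3 := congrArg (b.coord i) (h φ hφ)
    rw [map_zero] at h3
    rw [← h3]
    clear h3 h ht
    induction t with
    | zero => simp
    | add s t hs ht => simp only [map_add, Finsupp.add_apply, hs, ht]
    | tmul x y => simp [mul_comm]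
  simpa using h2

end MinTensor

/-! ### Universal C*-algebras and the defining relations -/

namespace FreeStarAlgebra

variable {X : Type*} {C : Type*} [Ring C] [StarRing C] [Algebra ℂ C]

/-- The values of the symbols `x` and `x*` under the homomorphism that extends `f`. -/
def letterValue (f : X → C) (y : X × Bool) : C := if y.2 then star (f y.1) else f y.1

/-- The algebra homomorphism that extends `f`. -/
noncomputable def liftAlg (f : X → C) : FreeStarAlgebra X →ₐ[ℂ] C :=
  FreeAlgebra.lift ℂ (letterValue f)

theorem liftAlg_letter (f : X → C) (y : X × Bool) : liftAlg f (letter y) = letterValue f y :=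
  FreeAlgebra.lift_ι_apply _ _

/-- The universal property of the free *-algebra. -/
noncomputable def lift [StarModule ℂ C] (f : X → C) : FreeStarAlgebra X →⋆ₐ[ℂ] C where
  __ := liftAlg f
  map_star' a := by
    change liftAlg f (star a) = star (liftAlg f a)
    induction a using induction with
    | h0 c => rw [star_algebraMap_free, AlgHom.commutes, AlgHom.commutes, algebraMap_star_comm]
    | h1 y =>
      rw [star_letter, liftAlg_letter, liftAlg_letter]
      obtain ⟨x, b⟩ := y
      cases b <;> simp [letterValue]
    | h2 a b ha hb => rw [star_mul, map_mul, map_mul, star_mul, ha, hb]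
    | h3 a b ha hb => rw [star_add, map_add, map_add, star_add, ha, hb]

@[simp] theorem lift_gen [StarModule ℂ C] (f : X → C) (x : X) : lift f (gen x) = f x :=
  (liftAlg_letter f (x, false)).trans (if_neg Bool.false_ne_true)

theorem letter_true (x : X) : letter (x, true) = star (gen x) := by
  rw [gen, star_letter, Bool.not_false]

end FreeStarAlgebra

namespace CStarSeminorm

/-- The pull back of a C*-seminorm along a *-homomorphism. -/
noncomputable def comap {E F : Type*} [Ring E] [StarRing E] [Algebra ℂ E] [Ring F] [StarRing F] [Algebra ℂ F]
    (q : CStarSeminorm F) (f : E →⋆ₐ[ℂ] F) : CStarSeminorm E :=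
  { q.toSeminorm.comp f.toAlgHom.toLinearMap with
    mul_le' := fun x y => (congrArg q (map_mul f x y)).le.trans (q.mul_le' (f x) (f y))
    star_mul_self' := fun x => (congrArg q ((map_mul f _ x).trans
      (congrArg (· * f x) (map_star f x)))).trans (q.star_mul_self' (f x)) }

theorem comap_apply {E F : Type*} [Ring E] [StarRing E] [Algebra ℂ E] [Ring F] [StarRing F]
    [Algebra ℂ F] (q : CStarSeminorm F) (f : E →⋆ₐ[ℂ] F) (x : E) : q.comap f x = q (f x) := rfl

/-- The norm of a C*-algebra. -/
noncomputable def ofNorm (C : Type*) [CStarAlgebra C] : CStarSeminorm C :=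
  { normSeminorm ℂ C with
    mul_le' := norm_mul_le
    star_mul_self' := fun x => by
      change ‖star x * x‖ = ‖x‖ ^ 2
      rw [CStarRing.norm_star_mul_self, sq] }

open scoped CStarAlgebra in
/-- *-homomorphisms of C*-algebras that agree on a dense *-subalgebra are equal. -/
theorem completion_hom_ext {E : Type*} [Ring E] [StarRing E] [Algebra ℂ E] [StarModule ℂ E]
    (p : CStarSeminorm E) {C : Type*} [CStarAlgebra C] {f g : p.Completion →⋆ₐ[ℂ] C}
    (h : ∀ x, f (p.of x) = g (p.of x)) : f = g :=
  DFunLike.coe_injective (p.denseRange_of.equalizer (map_continuous f) (map_continuous g)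
    (funext h))

end CStarSeminorm

section Universal

variable {X : Type*} {R : Set (FreeStarAlgebra X)} {hR : IsBoundedRel R}

theorem le_universalSeminorm {q : CStarSeminorm (FreeStarAlgebra X)} (hq : q ∈ relSeminorms R)
    (x : FreeStarAlgebra X) : q x ≤ universalSeminorm R hR x := by
  obtain ⟨c, -, hc⟩ := relSeminorms_bdd hR x
  exact le_ciSup (f := fun q : relSeminorms R => q.1 x)
    ⟨c, by rintro _ ⟨q, rfl⟩; exact hc q.1 q.2⟩ ⟨q, hq⟩

theorem universalSeminorm_rel {x : FreeStarAlgebra X} (hx : x ∈ R) :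
    (universalSeminorm R hR).of x = 0 := by
  have : Nonempty (relSeminorms R) := ⟨⟨CStarSeminorm.zero _, fun _ _ => rfl⟩⟩
  rw [← norm_eq_zero, CStarSeminorm.norm_of]
  refine le_antisymm (ciSup_le fun q => (q.2 x hx).le) ((universalSeminorm R hR).nonneg x)

namespace UniversalCStarAlgebra

variable {C : Type*} [CStarAlgebra C]

theorem norm_lift_le (f : X → C) (hf : ∀ r ∈ R, FreeStarAlgebra.lift f r = 0)
    (x : FreeStarAlgebra X) : ‖FreeStarAlgebra.lift f x‖ ≤ universalSeminorm R hR x :=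
  le_universalSeminorm (q := (CStarSeminorm.ofNorm C).comap (FreeStarAlgebra.lift f))
    (fun r hr => (congrArg norm (hf r hr)).trans norm_zero) x

/-- The universal property of the universal C*-algebra. -/
noncomputable def lift (f : X → C) (hf : ∀ r ∈ R, FreeStarAlgebra.lift f r = 0) :
    UniversalCStarAlgebra R hR →⋆ₐ[ℂ] C :=
  (universalSeminorm R hR).lift (FreeStarAlgebra.lift f) (norm_lift_le f hf)

theorem lift_of (f : X → C) (hf : ∀ r ∈ R, FreeStarAlgebra.lift f r = 0) (x : FreeStarAlgebra X) :
    lift (hR := hR) f hf ((universalSeminorm R hR).of x) = FreeStarAlgebra.lift f x :=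
  (universalSeminorm R hR).lift_of _ _ x

/-- The *-subalgebra generated by the generators. -/
noncomputable def core (R : Set (FreeStarAlgebra X)) (hR : IsBoundedRel R) :
    StarSubalgebra ℂ (UniversalCStarAlgebra R hR) := (universalSeminorm R hR).of.range

theorem dense_core : Dense (core R hR : Set (UniversalCStarAlgebra R hR)) :=
  (universalSeminorm R hR).denseRange_of

/-- The free *-algebra maps onto the *-subalgebra generated by the generators. -/
noncomputable def toCore (R : Set (FreeStarAlgebra X)) (hR : IsBoundedRel R) :
    FreeStarAlgebra X →⋆ₐ[ℂ] core R hR :=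
  (universalSeminorm R hR).of.codRestrict _ fun x => ⟨x, rfl⟩

theorem toCore_surjective : Function.Surjective (toCore R hR) := by
  rintro ⟨_, x, rfl⟩
  exact ⟨x, rfl⟩

theorem le_norm_core (q : CStarSeminorm (core R hR)) (a : core R hR) :
    q a ≤ ‖(a : UniversalCStarAlgebra R hR)‖ := by
  obtain ⟨x, rfl⟩ := toCore_surjective a
  refine (le_universalSeminorm (hR := hR) (q := q.comap (toCore R hR)) (fun r hr => ?_) x).trans
    ((universalSeminorm R hR).norm_of x).ge
  rw [CStarSeminorm.comap_apply,
    show toCore R hR r = 0 from Subtype.ext (universalSeminorm_rel hr)]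
  exact map_zero q.toSeminorm

end UniversalCStarAlgebra

end Universal

/-- The relations of the quantum automorphism group of the matrix algebra, for a family of elements
of a *-ring: `u k l i j` has upper indices `k l` and lower indices `i j`. -/
structure IsAutFamily {n : ℕ} {C : Type*} [Ring C] [StarRing C]
    (u : Fin n → Fin n → Fin n → Fin n → C) : Prop where
  mul : ∀ i j k l r s, ∑ v, u k v i j * u v l r s = if j = r then u k l i s else 0
  mul' : ∀ i j k l r s, ∑ v, u s r l v * u j i v k = if j = r then u s i l k else 0
  adj : ∀ i j k l, star (u k l i j) = u l k j i
  unit : ∀ k l, ∑ r, u k l r r = if k = l then 1 else 0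
  trace : ∀ k l, ∑ r, u r r k l = if k = l then 1 else 0

/-- The matrix `u` is an isometry: `u* u = 1`. -/
theorem IsAutFamily.sum_star_mul {n : ℕ} {C : Type*} [Ring C] {u : Fin n → Fin n → Fin n → Fin n → C}
    (hmul : ∀ i j k l r s, ∑ v, u k v i j * u v l r s =
      if j = r then u k l i s else 0)
    (htrace : ∀ k l, ∑ r, u r r k l = if k = l then 1 else 0) (i j k l : Fin n) :
    ∑ r, ∑ s, u s r l k * u r s i j = if k = i ∧ l = j then 1 else 0 := by
  rw [Finset.sum_comm]
  simp only [hmul]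
  by_cases h : k = i
  · simp [h, htrace]
  · simp [h]

namespace IsAutFamily

variable {n : ℕ} {C : Type*} [Ring C] [StarRing C] {u : Fin n → Fin n → Fin n → Fin n → C}

theorem lift_rel [Algebra ℂ C] [StarModule ℂ C] (hu : IsAutFamily u)
    (x : FreeStarAlgebra (Fin n × Fin n × Fin n × Fin n)) (hx : AutRel n x) :
    FreeStarAlgebra.lift (fun p => u p.1 p.2.1 p.2.2.1 p.2.2.2) x = 0 := by
  have h : ∀ k l i j, FreeStarAlgebra.lift (fun p : Fin n × Fin n × Fin n × Fin n =>
      u p.1 p.2.1 p.2.2.1 p.2.2.2) (symb k l i j) = u k l i j := fun k l i j =>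
    FreeStarAlgebra.lift_gen _ _
  induction hx with
  | mul i j k l r s =>
    simp only [map_sub, map_sum, map_mul, h, hu.mul]; split_ifs <;> simp [h]
  | mul' i j k l r s =>
    simp only [map_sub, map_sum, map_mul, h, hu.mul']; split_ifs <;> simp [h]
  | adj i j k l => rw [map_sub, map_star, h, h, hu.adj, sub_self]
  | unit k l => simp only [map_sub, map_sum, h, hu.unit]; split_ifs <;> simp
  | trace k l => simp only [map_sub, map_sum, h, hu.trace]; split_ifs <;> simp

/-- The second multiplication rule follows from the first one, the trace condition and the
invertibility of `u`: with `c = u⁻¹`, it is the relation `m (u ⊗ u)⁻¹ = u⁻¹ m` for the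
multiplication map `m`, and `m (u ⊗ u) = u m` is the first multiplication rule. -/
theorem of_rightInverse (hmul : ∀ i j k l r s, ∑ v, u k v i j * u v l r s =
      if j = r then u k l i s else 0)
    (hadj : ∀ i j k l, star (u k l i j) = u l k j i)
    (hunit : ∀ k l, ∑ r, u k l r r = if k = l then 1 else 0)
    (htrace : ∀ k l, ∑ r, u r r k l = if k = l then 1 else 0)
    (w : Fin n → Fin n → Fin n → Fin n → C)
    (hw : ∀ i j k l, ∑ r, ∑ s, u k l r s * w r s i j = if k = i ∧ l = j then 1 else 0) :
    IsAutFamily u := by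
  refine ⟨hmul, ?_, hadj, hunit, htrace⟩
  have hcu := sum_star_mul hmul htrace
  have huc : ∀ i j k l, ∑ r, ∑ s, u k l r s * u j i s r = if k = i ∧ l = j then 1 else 0 := by
    let U : Matrix (Fin n × Fin n) (Fin n × Fin n) C := .of fun p q => u p.1 p.2 q.1 q.2
    let V : Matrix (Fin n × Fin n) (Fin n × Fin n) C := .of fun p q => u q.2 q.1 p.2 p.1
    let W : Matrix (Fin n × Fin n) (Fin n × Fin n) C := .of fun p q => w p.1 p.2 q.1 q.2
    have h1 : V * U = 1 := by
      ext p q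
      simp only [Matrix.mul_apply, Fintype.sum_prod_type, V, U, Matrix.of_apply, hcu,
        Matrix.one_apply, Prod.ext_iff]
    have h2 : U * W = 1 := by
      ext p q
      simp only [Matrix.mul_apply, Fintype.sum_prod_type, W, U, Matrix.of_apply, hw,
        Matrix.one_apply, Prod.ext_iff]
    have h3 : U * V = 1 := by rw [left_inv_eq_right_inv h1 h2, h2]
    intro i j k l
    have h4 := congrFun (congrFun h3 (k, l)) (i, j)
    simpa only [Matrix.mul_apply, Fintype.sum_prod_type, V, U, Matrix.of_apply,
      Matrix.one_apply, Prod.ext_iff] using h4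
  intro i j k l r s
  -- `u` annihilates the difference of the two sides, and `u` is left invertible
  have hT : ∀ K L, ∑ k, ∑ l, u K L k l * (∑ v, u s r l v * u j i v k) =
      ∑ k, ∑ l, u K L k l * (if j = r then u s i l k else 0) := by
    intro K L
    have e1 : ∀ k v, ∑ l, u K L k l * (u s r l v * u j i v k) =
        ∑ x, u K x k v * ((∑ w, ∑ l, u x L w l * u s r l w) * u j i v k) := by
      intro k v
      calc ∑ l, u K L k l * (u s r l v * u j i v k)
          = ∑ w, ∑ l, (∑ x, u K x k v * u x L w l) * (u s r l w * u j i v k) := by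
            simp only [hmul, ite_mul, zero_mul, Finset.sum_ite_irrel, Finset.sum_const_zero,
              Finset.sum_ite_eq, Finset.mem_univ, if_true]
        _ = ∑ w, ∑ x, ∑ l, u K x k v * (u x L w l * u s r l w * u j i v k) := by
            refine Finset.sum_congr rfl fun w _ => ?_
            rw [Finset.sum_comm]
            refine Finset.sum_congr rfl fun l _ => ?_
            simp only [Finset.sum_mul, mul_assoc]
        _ = _ := by
            rw [Finset.sum_comm]
            refine Finset.sum_congr rfl fun x _ => ?_
            simp only [Finset.sum_mul, Finset.mul_sum]
    have e2 : ∑ k, ∑ l, u K L k l * (∑ v, u s r l v * u j i v k) =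
        ∑ k, ∑ v, ∑ x, u K x k v * ((∑ w, ∑ l, u x L w l * u s r l w) * u j i v k) := by
      refine Finset.sum_congr rfl fun k _ => ?_
      simp only [← e1, Finset.mul_sum]
      exact Finset.sum_comm
    rw [e2]
    simp only [huc]
    by_cases hL : L = s
    · simp only [hL, and_true, ite_mul, one_mul, zero_mul, mul_ite, mul_zero, Finset.sum_ite_eq',
        Finset.mem_univ, if_true, huc, Finset.sum_ite_irrel,
        Finset.sum_const_zero]
      by_cases hj : j = r
      · simp [hj]
      · simp [hj, Ne.symm hj]
    · simp only [hL, and_false, if_false, zero_mul, mul_zero, Finset.sum_const_zero, mul_ite,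
        Finset.sum_ite_irrel, huc, ite_self]
  have hcancel : ∀ x : Fin n → Fin n → C,
      ∑ K, ∑ L, u L K l k * (∑ k', ∑ l', u K L k' l' * x k' l') = x k l := by
    intro x
    calc _ = ∑ k', ∑ l', (∑ K, ∑ L, u L K l k * u K L k' l') * x k' l' := by
          simp only [Finset.mul_sum, Finset.sum_mul, mul_assoc]
          calc _ = ∑ K, ∑ k', ∑ L, ∑ l', u L K l k * (u K L k' l' * x k' l') :=
                Finset.sum_congr rfl fun K _ => Finset.sum_comm
            _ = ∑ k', ∑ K, ∑ l', ∑ L, u L K l k * (u K L k' l' * x k' l') := by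
                rw [Finset.sum_comm]
                exact Finset.sum_congr rfl fun k' _ => Finset.sum_congr rfl fun K _ =>
                  Finset.sum_comm
            _ = _ := Finset.sum_congr rfl fun k' _ => Finset.sum_comm
      _ = x k l := by
          simp only [hcu, ite_and, ite_mul, one_mul, zero_mul, Finset.sum_ite_irrel,
            Finset.sum_const_zero, Finset.sum_ite_eq, Finset.mem_univ, if_true]
  rw [← hcancel fun k l => ∑ v, u s r l v * u j i v k]
  simp only [hT]
  exact hcancel fun k l => if j = r then u s i l k else 0

end IsAutFamily

/-! ### Operations on solutions of the relations, and the dense *-subalgebra -/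

namespace IsAutFamily

open MulOpposite

variable {n : ℕ} {C D : Type*} [Ring C] [StarRing C] [Ring D] [StarRing D]
  {u w : Fin n → Fin n → Fin n → Fin n → C}

/-- Passage to the inverse matrix `u⁻¹ = u*` and to the opposite algebra exchanges the two
multiplication rules. -/
theorem op (hu : IsAutFamily u) : IsAutFamily fun k l i j => op (u j i l k) where
  mul i j k l r s := by
    simp only [← op_mul, ← Finset.op_sum, hu.mul', apply_ite MulOpposite.op, op_zero]
  mul' i j k l r s := by
    simp only [← op_mul, ← Finset.op_sum, hu.mul, apply_ite MulOpposite.op, op_zero]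
  adj i j k l := by rw [← op_star, hu.adj]
  unit k l := by
    rw [← Finset.op_sum, hu.trace, apply_ite MulOpposite.op, op_zero, op_one]
    simp only [eq_comm]
  trace k l := by
    rw [← Finset.op_sum, hu.unit, apply_ite MulOpposite.op, op_zero, op_one]
    simp only [eq_comm]

theorem map [Algebra ℂ C] [Algebra ℂ D] (f : C →⋆ₐ[ℂ] D) (hu : IsAutFamily u) :
    IsAutFamily fun k l i j => f (u k l i j) where
  mul i j k l r s := by
    simp only [← map_mul, ← map_sum, hu.mul]; split_ifs <;> simp
  mul' i j k l r s := by
    simp only [← map_mul, ← map_sum, hu.mul']; split_ifs <;> simp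
  adj i j k l := by rw [← map_star, hu.adj]
  unit k l := by rw [← map_sum, hu.unit]; split_ifs <;> simp
  trace k l := by rw [← map_sum, hu.trace]; split_ifs <;> simp

theorem of_injective [Algebra ℂ C] [Algebra ℂ D] (f : C →⋆ₐ[ℂ] D) (hf : Function.Injective f)
    (hu : IsAutFamily fun k l i j => f (u k l i j)) : IsAutFamily u where
  mul i j k l r s := hf <| by
    simp only [map_sum, map_mul, hu.mul]; split_ifs <;> simp
  mul' i j k l r s := hf <| by
    simp only [map_sum, map_mul, hu.mul']; split_ifs <;> simp
  adj i j k l := hf <| by rw [map_star, hu.adj]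
  unit k l := hf <| by rw [map_sum, hu.unit]; split_ifs <;> simp
  trace k l := hf <| by rw [map_sum, hu.trace]; split_ifs <;> simp

end IsAutFamily

/-- The matrix product of two families, with respect to pairs of indices. -/
def autMul {n : ℕ} {C : Type*} [Ring C] (u w : Fin n → Fin n → Fin n → Fin n → C)
    (k l i j : Fin n) : C := ∑ p, ∑ q, u k l p q * w p q i j

theorem autMul_rule {n : ℕ} {C : Type*} [Ring C] {u w : Fin n → Fin n → Fin n → Fin n → C}
    (hu : ∀ i j k l r s, ∑ v, u k v i j * u v l r s = if j = r then u k l i s else 0)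
    (hw : ∀ i j k l r s, ∑ v, w k v i j * w v l r s = if j = r then w k l i s else 0)
    (hc : ∀ i j k l i' j' k' l', Commute (u k l i j) (w k' l' i' j')) (i j k l r s : Fin n) :
    ∑ v, autMul u w k v i j * autMul u w v l r s = if j = r then autMul u w k l i s else 0 := by
  calc ∑ v, autMul u w k v i j * autMul u w v l r s
      = ∑ p, ∑ y, ∑ q, ∑ x, (∑ v, u k v p q * u v l x y) * (w p q i j * w x y r s) := by
        simp only [autMul, Finset.sum_mul, Finset.mul_sum]
        let F : Fin n → Fin n → Fin n → Fin n → Fin n → C := fun p y q x v =>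
          u k v p q * w p q i j * (u v l x y * w x y r s)
        calc ∑ v, ∑ x, ∑ y, ∑ p, ∑ q, F p y q x v
            = ∑ v, ∑ x, ∑ p, ∑ y, ∑ q, F p y q x v :=
              Finset.sum_congr rfl fun v _ => Finset.sum_congr rfl fun x _ => Finset.sum_comm
          _ = ∑ v, ∑ p, ∑ x, ∑ y, ∑ q, F p y q x v :=
              Finset.sum_congr rfl fun v _ => Finset.sum_comm
          _ = ∑ p, ∑ v, ∑ x, ∑ y, ∑ q, F p y q x v := Finset.sum_comm
          _ = ∑ p, ∑ v, ∑ y, ∑ x, ∑ q, F p y q x v :=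
              Finset.sum_congr rfl fun p _ => Finset.sum_congr rfl fun v _ => Finset.sum_comm
          _ = ∑ p, ∑ y, ∑ v, ∑ x, ∑ q, F p y q x v :=
              Finset.sum_congr rfl fun p _ => Finset.sum_comm
          _ = ∑ p, ∑ y, ∑ v, ∑ q, ∑ x, F p y q x v :=
              Finset.sum_congr rfl fun p _ => Finset.sum_congr rfl fun y _ =>
                Finset.sum_congr rfl fun v _ => Finset.sum_comm
          _ = ∑ p, ∑ y, ∑ q, ∑ v, ∑ x, F p y q x v :=
              Finset.sum_congr rfl fun p _ => Finset.sum_congr rfl fun y _ => Finset.sum_comm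
          _ = ∑ p, ∑ y, ∑ q, ∑ x, ∑ v, F p y q x v :=
              Finset.sum_congr rfl fun p _ => Finset.sum_congr rfl fun y _ =>
                Finset.sum_congr rfl fun q _ => Finset.sum_comm
          _ = _ := by
              refine Finset.sum_congr rfl fun p _ => ?_
              refine Finset.sum_congr rfl fun y _ => Finset.sum_congr rfl fun q _ =>
                Finset.sum_congr rfl fun x _ => Finset.sum_congr rfl fun v _ => ?_
              dsimp only [F]
              rw [mul_assoc, ← mul_assoc (w p q i j), ← (hc _ _ _ _ _ _ _ _).eq, mul_assoc,
                mul_assoc]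
    _ = ∑ p, ∑ y, u k l p y * ∑ q, w p q i j * w q y r s := by
        simp only [hu, ite_mul, zero_mul, Finset.sum_ite_eq, Finset.mem_univ, if_true,
          Finset.mul_sum]
    _ = _ := by
        simp only [hw, autMul]
        split_ifs <;> simp

/-- The matrix product of two families whose entries commute satisfies the relations. -/
theorem IsAutFamily.autMul {n : ℕ} {C : Type*} [Ring C] [StarRing C]
    {u w : Fin n → Fin n → Fin n → Fin n → C} (hu : IsAutFamily u) (hw : IsAutFamily w)
    (hc : ∀ i j k l i' j' k' l', Commute (u k l i j) (w k' l' i' j')) :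
    IsAutFamily (autMul u w) where
  mul := autMul_rule hu.mul hw.mul hc
  mul' i j k l r s := by
    have h := autMul_rule hw.op.mul hu.op.mul (fun i j k l i' j' k' l' =>
      congrArg MulOpposite.op (hc _ _ _ _ _ _ _ _).eq) i j k l r s
    have e : ∀ k l i j, _root_.autMul (fun k l i j => MulOpposite.op (w j i l k))
        (fun k l i j => MulOpposite.op (u j i l k)) k l i j =
          MulOpposite.op (_root_.autMul u w j i l k) := fun k l i j => by
      simp only [_root_.autMul, ← MulOpposite.op_mul, ← Finset.op_sum]
      rw [Finset.sum_comm]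
    simp only [e, ← MulOpposite.op_mul, ← Finset.op_sum] at h
    apply MulOpposite.op_injective
    rw [h]
    split_ifs <;> simp
  adj i j k l := by
    simp only [_root_.autMul, star_sum, star_mul, hu.adj, hw.adj]
    rw [Finset.sum_comm]
    exact Finset.sum_congr rfl fun p _ => Finset.sum_congr rfl fun q _ =>
      (hc _ _ _ _ _ _ _ _).symm.eq
  unit k l := by
    simp only [_root_.autMul]
    rw [Finset.sum_comm]
    calc _ = ∑ p, ∑ q, u k l p q * ∑ r, w p q r r := by
          simp only [Finset.mul_sum]
          exact Finset.sum_congr rfl fun p _ => Finset.sum_comm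
      _ = _ := by simp [hw.unit, hu.unit]
  trace k l := by
    simp only [_root_.autMul]
    rw [Finset.sum_comm]
    calc _ = ∑ p, ∑ q, (∑ r, u r r p q) * w p q k l := by
          simp only [Finset.sum_mul]
          exact Finset.sum_congr rfl fun p _ => Finset.sum_comm
      _ = _ := by simp [hu.trace, hw.trace]

/-- The identity matrix satisfies the relations. -/
theorem isAutFamily_one (n : ℕ) (C : Type*) [Ring C] [StarRing C] :
    IsAutFamily fun k l i j : Fin n => if k = i ∧ l = j then (1 : C) else 0 where
  mul i j k l r s := by
    simp only [ite_and, ite_mul, one_mul, zero_mul]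
    by_cases h : k = i <;> by_cases h2 : j = r <;> simp [h, h2, eq_comm]
  mul' i j k l r s := by
    by_cases h : s = l <;> by_cases h2 : j = r <;> simp [h, h2, ite_and, eq_comm]
  adj i j k l := by simp only [and_comm, apply_ite star, star_one, star_zero]
  unit k l := by simp [ite_and, eq_comm]
  trace k l := by simp [ite_and]

namespace Aaut

variable {n : ℕ}

theorem isAutFamily_agen (n : ℕ) : IsAutFamily (agen (n := n)) where
  mul i j k l r s := by
    have h := universalSeminorm_rel (hR := autRel_bounded n) (AutRel.mul i j k l r s)
    rw [map_sub, sub_eq_zero, map_sum] at h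
    simp only [map_mul] at h
    refine h.trans ?_
    split_ifs
    · rfl
    · exact map_zero _
  mul' i j k l r s := by
    have h := universalSeminorm_rel (hR := autRel_bounded n) (AutRel.mul' i j k l r s)
    rw [map_sub, sub_eq_zero, map_sum] at h
    simp only [map_mul] at h
    refine h.trans ?_
    split_ifs
    · rfl
    · exact map_zero _
  adj i j k l := by
    have h := universalSeminorm_rel (hR := autRel_bounded n) (AutRel.adj i j k l)
    rwa [map_sub, sub_eq_zero, map_star] at h
  unit k l := by
    have h := universalSeminorm_rel (hR := autRel_bounded n) (AutRel.unit k l)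
    rw [map_sub, sub_eq_zero, map_sum] at h
    refine h.trans ?_
    split_ifs
    · exact map_one _
    · exact map_zero _
  trace k l := by
    have h := universalSeminorm_rel (hR := autRel_bounded n) (AutRel.trace k l)
    rw [map_sub, sub_eq_zero, map_sum] at h
    refine h.trans ?_
    split_ifs
    · exact map_one _
    · exact map_zero _

section lift

variable {C : Type*} [CStarAlgebra C] {u : Fin n → Fin n → Fin n → Fin n → C}

/-- The universal property of `Aaut n`. -/
noncomputable def lift (hu : IsAutFamily u) : Aaut n →⋆ₐ[ℂ] C :=
  UniversalCStarAlgebra.lift (fun p => u p.1 p.2.1 p.2.2.1 p.2.2.2) hu.lift_rel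

@[simp] theorem lift_agen (hu : IsAutFamily u) (k l i j : Fin n) :
    lift hu (agen k l i j) = u k l i j :=
  (UniversalCStarAlgebra.lift_of _ hu.lift_rel _).trans (FreeStarAlgebra.lift_gen _ _)

end lift

/-- The *-subalgebra of `Aaut n` generated by the entries of the fundamental matrix. -/
noncomputable abbrev core (n : ℕ) : StarSubalgebra ℂ (Aaut n) :=
  UniversalCStarAlgebra.core {x | AutRel n x} (autRel_bounded n)

/-- The generators, as elements of the dense *-subalgebra. -/
noncomputable def cgen (k l i j : Fin n) : core n := ⟨agen k l i j, _, rfl⟩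

theorem isAutFamily_cgen (n : ℕ) : IsAutFamily (cgen (n := n)) :=
  .of_injective (core n).subtype Subtype.val_injective (isAutFamily_agen n)

/-- The dense *-subalgebra is generated by the generators as an algebra, since the set of generators
is closed under the involution. -/
theorem core_induction {P : core n → Prop} (h0 : ∀ c : ℂ, P (algebraMap ℂ _ c))
    (h1 : ∀ k l i j, P (cgen k l i j)) (h2 : ∀ a b, P a → P b → P (a * b))
    (h3 : ∀ a b, P a → P b → P (a + b)) (a : core n) : P a := by
  obtain ⟨x, rfl⟩ := UniversalCStarAlgebra.toCore_surjective a
  induction x using FreeStarAlgebra.induction with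
  | h0 c => rw [AlgHomClass.commutes]; exact h0 c
  | h1 y =>
    obtain ⟨⟨k, l, i, j⟩, b⟩ := y
    cases b with
    | false => exact h1 k l i j
    | true =>
      rw [FreeStarAlgebra.letter_true, map_star]
      have : star (cgen k l i j) = cgen l k j i := (isAutFamily_cgen n).adj _ _ _ _
      exact (congrArg P this).mpr (h1 _ _ _ _)
  | h2 a b ha hb => rw [map_mul]; exact h2 _ _ ha hb
  | h3 a b ha hb => rw [map_add]; exact h3 _ _ ha hb

theorem core_algHom_ext {D : Type*} [Semiring D] [Algebra ℂ D] {f g : core n →ₐ[ℂ] D}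
    (h : ∀ k l i j, f (cgen k l i j) = g (cgen k l i j)) : f = g :=
  AlgHom.ext <| core_induction (fun c => by rw [AlgHom.commutes, AlgHom.commutes]) h
    (fun a b ha hb => by rw [map_mul, map_mul, ha, hb])
    (fun a b ha hb => by rw [map_add, map_add, ha, hb])

theorem hom_ext {C : Type*} [CStarAlgebra C] {f g : Aaut n →⋆ₐ[ℂ] C}
    (h : ∀ k l i j, f (agen k l i j) = g (agen k l i j)) : f = g := by
  have h2 : f.toAlgHom.comp (core n).subtype.toAlgHom = g.toAlgHom.comp (core n).subtype.toAlgHom :=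
    core_algHom_ext h
  exact CStarSeminorm.completion_hom_ext _ fun x =>
    DFunLike.congr_fun h2 (UniversalCStarAlgebra.toCore _ _ x)

end Aaut

/-! ### The compact quantum group -/

theorem sum_comm_pairs {ι M : Type*} [Fintype ι] [AddCommMonoid M] (F : ι → ι → ι → ι → M) :
    ∑ p, ∑ q, ∑ r, ∑ s, F p q r s = ∑ r, ∑ s, ∑ p, ∑ q, F p q r s := by
  calc ∑ p, ∑ q, ∑ r, ∑ s, F p q r s = ∑ p, ∑ r, ∑ q, ∑ s, F p q r s :=
        Finset.sum_congr rfl fun _ _ => Finset.sum_comm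
    _ = ∑ r, ∑ p, ∑ q, ∑ s, F p q r s := Finset.sum_comm
    _ = ∑ r, ∑ p, ∑ s, ∑ q, F p q r s :=
        Finset.sum_congr rfl fun _ _ => Finset.sum_congr rfl fun _ _ => Finset.sum_comm
    _ = ∑ r, ∑ s, ∑ p, ∑ q, F p q r s := Finset.sum_congr rfl fun _ _ => Finset.sum_comm

section Algebra

/-- The algebraic tensor product of two *-homomorphisms of *-algebras. -/
noncomputable def starTensorMap {E F E' F' : Type*} [Ring E] [StarRing E] [Algebra ℂ E]
    [StarModule ℂ E] [Ring F] [StarRing F] [Algebra ℂ F] [StarModule ℂ F]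
    [Ring E'] [StarRing E'] [Algebra ℂ E'] [StarModule ℂ E']
    [Ring F'] [StarRing F'] [Algebra ℂ F'] [StarModule ℂ F']
    (f : E →⋆ₐ[ℂ] E') (g : F →⋆ₐ[ℂ] F') : E ⊗[ℂ] F →⋆ₐ[ℂ] E' ⊗[ℂ] F' where
  __ := Algebra.TensorProduct.map f.toAlgHom g.toAlgHom
  map_star' t := by
    change Algebra.TensorProduct.map f.toAlgHom g.toAlgHom (star t) =
      star (Algebra.TensorProduct.map f.toAlgHom g.toAlgHom t)
    induction t with
    | zero => simp
    | add s t hs ht => rw [star_add, map_add, hs, ht, map_add, star_add]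
    | tmul a b => simp [StarHomClass.map_star]

/-- A *-homomorphism into the range of an injective *-homomorphism `j` factors through `j`. -/
theorem exists_starAlgHom_factor {E F D : Type*} [Ring E] [StarRing E] [Algebra ℂ E]
    [Ring F] [StarRing F] [Algebra ℂ F] [Ring D] [StarRing D] [Algebra ℂ D]
    (f : E →⋆ₐ[ℂ] D) (j : F →⋆ₐ[ℂ] D) (hj : Function.Injective j) (h : ∀ x, ∃ y, j y = f x) :
    ∃ g : E →⋆ₐ[ℂ] F, ∀ x, j (g x) = f x := by
  choose g hg using h
  exact ⟨{ toFun := g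
           map_one' := hj (by rw [hg, map_one, map_one])
           map_mul' := fun x y => hj (by rw [hg, map_mul, map_mul, hg, hg])
           map_zero' := hj (by rw [hg, map_zero, map_zero])
           map_add' := fun x y => hj (by rw [hg, map_add, map_add, hg, hg])
           commutes' := fun c => hj (by rw [hg, AlgHomClass.commutes, AlgHomClass.commutes])
           map_star' := fun x => hj (by rw [hg, map_star, map_star, hg]) }, hg⟩

variable {P : Type*} [Ring P] [Algebra ℂ P] {κ : P →ₗ[ℂ] P}

/-- The identity `κ(x₁) x₂ = ε(x) 1` for `t = Δ x` reduces the same identity for a product `t * s` to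
that for `s`, if `κ` is antimultiplicative. -/
theorem mul_antipode_rTensor_mul (hκ : ∀ a b, κ (a * b) = κ b * κ a) {s t : P ⊗[ℂ] P} {c : ℂ}
    (ht : LinearMap.mul' ℂ P (κ.rTensor P t) = algebraMap ℂ P c) :
    LinearMap.mul' ℂ P (κ.rTensor P (t * s)) =
      algebraMap ℂ P c * LinearMap.mul' ℂ P (κ.rTensor P s) := by
  induction s with
  | zero => simp
  | add s s' h h' => simp only [mul_add, map_add, h, h']
  | tmul x y =>
    have h : ∀ t : P ⊗[ℂ] P, LinearMap.mul' ℂ P (κ.rTensor P (t * x ⊗ₜ y)) =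
        κ x * LinearMap.mul' ℂ P (κ.rTensor P t) * y := fun t => by
      induction t with
      | zero => simp
      | add s s' h h' => simp only [add_mul, mul_add, map_add, h, h']
      | tmul a b => simp [hκ, mul_assoc]
    rw [h, ht, ← Algebra.commutes, mul_assoc]
    simp

/-- The identity `x₁ κ(x₂) = ε(x) 1` for `s = Δ x` reduces the same identity for a product `t * s` to
that for `t`, if `κ` is antimultiplicative. -/
theorem mul_antipode_lTensor_mul (hκ : ∀ a b, κ (a * b) = κ b * κ a) {s t : P ⊗[ℂ] P} {c : ℂ}
    (hs : LinearMap.mul' ℂ P (κ.lTensor P s) = algebraMap ℂ P c) :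
    LinearMap.mul' ℂ P (κ.lTensor P (t * s)) =
      LinearMap.mul' ℂ P (κ.lTensor P t) * algebraMap ℂ P c := by
  induction t with
  | zero => simp
  | add s s' h h' => simp only [add_mul, map_add, h, h']
  | tmul x y =>
    have h : ∀ s : P ⊗[ℂ] P, LinearMap.mul' ℂ P (κ.lTensor P (x ⊗ₜ y * s)) =
        x * LinearMap.mul' ℂ P (κ.lTensor P s) * κ y := fun s => by
      induction s with
      | zero => simp
      | add s s' h h' => simp only [add_mul, mul_add, map_add, h, h']
      | tmul a b => simp [hκ, mul_assoc]
    rw [h, hs, mul_assoc, Algebra.commutes, ← mul_assoc]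
    simp

end Algebra

/-- A *-algebra generated by a family of elements that satisfies the relations is a Hopf *-algebra,
if the usual formulas for a comultiplication, a counit and an antipode on the generators extend to
it. -/
noncomputable def hopfOfAutFamily {n : ℕ} {P : Type*} [Ring P] [StarRing P] [Algebra ℂ P]
    [StarModule ℂ P] {u : Fin n → Fin n → Fin n → Fin n → P} (hu : IsAutFamily u)
    (hind : ∀ {Q : P → Prop}, (∀ c : ℂ, Q (algebraMap ℂ P c)) → (∀ k l i j, Q (u k l i j)) →
      (∀ a b, Q a → Q b → Q (a * b)) → (∀ a b, Q a → Q b → Q (a + b)) → ∀ a, Q a)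
    (Δ : P →⋆ₐ[ℂ] P ⊗[ℂ] P) (hΔ : ∀ k l i j, Δ (u k l i j) = ∑ r, ∑ s, u k l r s ⊗ₜ u r s i j)
    (ε : P →⋆ₐ[ℂ] ℂ) (hε : ∀ k l i j, ε (u k l i j) = if k = i ∧ l = j then 1 else 0)
    (κ : P →ₗ[ℂ] P) (hκ : ∀ k l i j, κ (u k l i j) = u j i l k) (hκ1 : κ 1 = 1)
    (hκm : ∀ a b, κ (a * b) = κ b * κ a) : HopfStarStructure P :=
  have hext : ∀ {D : Type _} [Semiring D] [Algebra ℂ D] {f g : P →ₐ[ℂ] D},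
      (∀ k l i j, f (u k l i j) = g (u k l i j)) → f = g := fun h =>
    AlgHom.ext <| hind (fun c => by rw [AlgHom.commutes, AlgHom.commutes]) h
      (fun a b ha hb => by rw [map_mul, map_mul, ha, hb])
      (fun a b ha hb => by rw [map_add, map_add, ha, hb])
  have hΔ' : ∀ k l i j, Δ.toAlgHom (u k l i j) = ∑ r, ∑ s, u k l r s ⊗ₜ u r s i j := hΔ
  have hε' : ∀ k l i j, ε.toAlgHom (u k l i j) = if k = i ∧ l = j then 1 else 0 := hε
  have hκc : ∀ c : ℂ, κ (algebraMap ℂ P c) = algebraMap ℂ P c := fun c => by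
    rw [Algebra.algebraMap_eq_smul_one, map_smul, hκ1]
  { comul := Δ
    counit := ε
    antipode := κ
    coassoc := by
      have h : ((Algebra.TensorProduct.assoc ℂ ℂ ℂ P P P).toAlgHom.comp
          (Algebra.TensorProduct.map Δ.toAlgHom (AlgHom.id ℂ P))).comp Δ.toAlgHom =
          (Algebra.TensorProduct.map (AlgHom.id ℂ P) Δ.toAlgHom).comp Δ.toAlgHom := by
        refine hext fun k l i j => ?_
        simp only [AlgHom.comp_apply, hΔ', map_sum, Algebra.TensorProduct.map_tmul,
          AlgHom.id_apply, TensorProduct.sum_tmul, TensorProduct.tmul_sum,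
          AlgEquiv.toAlgHom_apply, Algebra.TensorProduct.assoc_tmul]
        exact sum_comm_pairs fun p q r s => u k l r s ⊗ₜ (u r s p q ⊗ₜ u p q i j)
      exact congrArg AlgHom.toLinearMap h
    rTensor_counit_comp_comul := by
      have h : (Algebra.TensorProduct.map ε.toAlgHom (AlgHom.id ℂ P)).comp Δ.toAlgHom =
          Algebra.TensorProduct.includeRight := by
        refine hext fun k l i j => ?_
        rw [AlgHom.comp_apply, hΔ']
        simp only [map_sum, Algebra.TensorProduct.map_tmul, hε', AlgHom.id_apply]
        rw [Finset.sum_eq_single k, Finset.sum_eq_single l]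
        · simp
        all_goals simp +contextual [eq_comm]
      exact congrArg AlgHom.toLinearMap h
    lTensor_counit_comp_comul := by
      have h : (Algebra.TensorProduct.map (AlgHom.id ℂ P) ε.toAlgHom).comp Δ.toAlgHom =
          Algebra.TensorProduct.includeLeft := by
        refine hext fun k l i j => ?_
        rw [AlgHom.comp_apply, hΔ']
        simp only [map_sum, Algebra.TensorProduct.map_tmul, hε', AlgHom.id_apply]
        rw [Finset.sum_eq_single i, Finset.sum_eq_single j]
        · simp
        all_goals simp +contextual [eq_comm]
      exact congrArg AlgHom.toLinearMap h
    mul_antipode_rTensor_comul := by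
      refine LinearMap.ext <| hind (fun c => ?_) (fun k l i j => ?_) (fun a b ha hb => ?_)
        (fun a b ha hb => by rw [map_add, map_add, ha, hb])
      · change LinearMap.mul' ℂ _ (κ.rTensor _ (Δ (algebraMap ℂ P c))) =
          algebraMap ℂ P (ε (algebraMap ℂ P c))
        rw [AlgHomClass.commutes Δ, AlgHomClass.commutes ε, Algebra.TensorProduct.algebraMap_apply,
          LinearMap.rTensor_tmul, LinearMap.mul'_apply, hκc, mul_one]
        rfl
      · change LinearMap.mul' ℂ _ (κ.rTensor _ (Δ (u k l i j))) = algebraMap ℂ P (ε (u k l i j))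
        rw [hΔ, hε]
        simp only [map_sum, LinearMap.rTensor_tmul, LinearMap.mul'_apply, hκ]
        rw [IsAutFamily.sum_star_mul hu.mul hu.trace]
        split_ifs <;> simp
      · change LinearMap.mul' ℂ _ (κ.rTensor _ (Δ (a * b))) = algebraMap ℂ P (ε (a * b))
        change LinearMap.mul' ℂ _ (κ.rTensor _ (Δ a)) = algebraMap ℂ P (ε a) at ha
        change LinearMap.mul' ℂ _ (κ.rTensor _ (Δ b)) = algebraMap ℂ P (ε b) at hb
        rw [map_mul, mul_antipode_rTensor_mul hκm ha, hb, map_mul, map_mul]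
    mul_antipode_lTensor_comul := by
      refine LinearMap.ext <| hind (fun c => ?_) (fun k l i j => ?_) (fun a b ha hb => ?_)
        (fun a b ha hb => by rw [map_add, map_add, ha, hb])
      · change LinearMap.mul' ℂ _ (κ.lTensor _ (Δ (algebraMap ℂ P c))) =
          algebraMap ℂ P (ε (algebraMap ℂ P c))
        rw [AlgHomClass.commutes Δ, AlgHomClass.commutes ε, Algebra.TensorProduct.algebraMap_apply,
          LinearMap.lTensor_tmul, LinearMap.mul'_apply, hκ1, mul_one]
        rfl
      · change LinearMap.mul' ℂ _ (κ.lTensor _ (Δ (u k l i j))) = algebraMap ℂ P (ε (u k l i j))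
        rw [hΔ, hε]
        simp only [map_sum, LinearMap.lTensor_tmul, LinearMap.mul'_apply, hκ, hu.mul']
        by_cases h : l = j
        · by_cases h' : k = i <;> simp [h, h', hu.unit]
        · simp [h, Ne.symm h]
      · change LinearMap.mul' ℂ _ (κ.lTensor _ (Δ (a * b))) = algebraMap ℂ P (ε (a * b))
        change LinearMap.mul' ℂ _ (κ.lTensor _ (Δ a)) = algebraMap ℂ P (ε a) at ha
        change LinearMap.mul' ℂ _ (κ.lTensor _ (Δ b)) = algebraMap ℂ P (ε b) at hb
        rw [map_mul, mul_antipode_lTensor_mul hκm hb, ha, map_mul, map_mul] }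

namespace MinTensor

variable {A B : Type*} [CStarAlgebra A] [CStarAlgebra B]

theorem tmul_mul_tmul (a a' : A) (b b' : B) :
    tmul a b * tmul a' b' = tmul (a * a') (b * b') := by
  rw [tmul, tmul, ← map_mul, Algebra.TensorProduct.tmul_mul_tmul]; rfl

theorem star_tmul (a : A) (b : B) : star (tmul a b) = tmul (star a) (star b) := by
  rw [tmul, ← map_star, TensorProduct.star_tmul]; rfl

theorem one_def : (1 : MinTensor A B) = tmul 1 1 := (map_one (of A B)).symm

/-- The embedding of the first factor. -/
noncomputable def inl (A B : Type*) [CStarAlgebra A] [CStarAlgebra B] :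
    A →⋆ₐ[ℂ] MinTensor A B :=
  (of A B).comp
    { Algebra.TensorProduct.includeLeft (R := ℂ) (S := ℂ) (A := A) (B := B) with
      map_star' := fun a => by simp [TensorProduct.star_tmul] }

/-- The embedding of the second factor. -/
noncomputable def inr (A B : Type*) [CStarAlgebra A] [CStarAlgebra B] :
    B →⋆ₐ[ℂ] MinTensor A B :=
  (of A B).comp
    { Algebra.TensorProduct.includeRight (R := ℂ) (A := A) (B := B) with
      map_star' := fun a => by simp [TensorProduct.star_tmul] }

theorem inl_apply (a : A) : inl A B a = tmul a 1 := rfl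

theorem inr_apply (b : B) : inr A B b = tmul 1 b := rfl

theorem inl_mul_inr (a : A) (b : B) : inl A B a * inr A B b = tmul a b := by
  rw [inl_apply, inr_apply, tmul_mul_tmul, mul_one, one_mul]

theorem commute_inl_inr (a : A) (b : B) : Commute (inl A B a) (inr A B b) := by
  rw [Commute, SemiconjBy, inl_apply, inr_apply, tmul_mul_tmul, tmul_mul_tmul]
  simp

/-- The algebraic tensor product of *-subalgebras embeds into the minimal tensor product. -/
theorem of_subtype_injective (S : StarSubalgebra ℂ A) (T : StarSubalgebra ℂ B) :
    Function.Injective ((of A B).comp (starTensorMap S.subtype T.subtype)) :=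
  of_injective.comp (TensorProduct.map_injective_of_flat_flat
    S.subtype.toAlgHom.toLinearMap T.subtype.toAlgHom.toLinearMap
    Subtype.val_injective Subtype.val_injective)

end MinTensor

namespace Aaut

variable (n : ℕ)

/-- The coproduct on the C*-algebra. -/
noncomputable def comulHom : Aaut n →⋆ₐ[ℂ] MinTensor (Aaut n) (Aaut n) :=
  lift (((isAutFamily_agen n).map (MinTensor.inl _ _)).autMul
    ((isAutFamily_agen n).map (MinTensor.inr _ _)) fun _ _ _ _ _ _ _ _ =>
      MinTensor.commute_inl_inr _ _)

variable {n} in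
theorem comulHom_agen (k l i j : Fin n) : comulHom n (agen k l i j) =
    ∑ r, ∑ s, MinTensor.tmul (agen k l r s) (agen r s i j) := by
  rw [comulHom, lift_agen]
  simp only [autMul, MinTensor.inl_mul_inr]

/-- The coproduct maps the dense *-subalgebra to its algebraic tensor square. -/
theorem exists_comulCore : ∃ Δ : core n →⋆ₐ[ℂ] core n ⊗[ℂ] core n, ∀ a : core n,
    MinTensor.of _ _ (starTensorMap (core n).subtype (core n).subtype (Δ a)) = comulHom n a := by
  refine exists_starAlgHom_factor ((comulHom n).comp (core n).subtype)
    ((MinTensor.of _ _).comp (starTensorMap (core n).subtype (core n).subtype))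
    (MinTensor.of_subtype_injective _ _) fun a => ?_
  induction a using core_induction with
  | h0 c => exact ⟨algebraMap ℂ _ c, by rw [AlgHomClass.commutes, AlgHomClass.commutes]⟩
  | h1 k l i j =>
    refine ⟨∑ r, ∑ s, cgen k l r s ⊗ₜ cgen r s i j, ?_⟩
    simp only [map_sum]
    exact (comulHom_agen k l i j).symm
  | h2 a b ha hb =>
    obtain ⟨x, hx⟩ := ha
    obtain ⟨y, hy⟩ := hb
    exact ⟨x * y, by rw [map_mul, map_mul, hx, hy]⟩
  | h3 a b ha hb =>
    obtain ⟨x, hx⟩ := ha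
    obtain ⟨y, hy⟩ := hb
    exact ⟨x + y, by rw [map_add, map_add, hx, hy]⟩

/-- The comultiplication of the dense Hopf *-algebra. -/
noncomputable def comulCore : core n →⋆ₐ[ℂ] core n ⊗[ℂ] core n := (exists_comulCore n).choose

theorem of_comulCore (a : core n) : MinTensor.of _ _ (starTensorMap (core n).subtype
    (core n).subtype (comulCore n a)) = comulHom n a := (exists_comulCore n).choose_spec a

variable {n} in
theorem comulCore_cgen (k l i j : Fin n) :
    comulCore n (cgen k l i j) = ∑ r, ∑ s, cgen k l r s ⊗ₜ cgen r s i j := by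
  refine MinTensor.of_subtype_injective (core n) (core n) ?_
  refine (of_comulCore n _).trans ?_
  simp only [map_sum]
  exact comulHom_agen k l i j

/-- The counit, which maps the fundamental matrix to the identity matrix. -/
noncomputable def counitHom : Aaut n →⋆ₐ[ℂ] ℂ := lift (isAutFamily_one n ℂ)

/-- The antipode, as a *-homomorphism to the opposite algebra. -/
noncomputable def antipodeHom : Aaut n →⋆ₐ[ℂ] (Aaut n)ᵐᵒᵖ := lift (isAutFamily_agen n).op

theorem unop_antipodeHom_mem (a : core n) : (antipodeHom n a).unop ∈ core n := by
  induction a using core_induction with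
  | h0 c =>
    have : antipodeHom n (algebraMap ℂ (core n) c : core n) = algebraMap ℂ _ c :=
      AlgHomClass.commutes (antipodeHom n) c
    rw [this]
    exact (core n).algebraMap_mem c
  | h1 k l i j =>
    have : antipodeHom n (cgen k l i j : core n) = MulOpposite.op (agen j i l k) :=
      lift_agen _ _ _ _ _
    rw [this]
    exact (cgen j i l k).2
  | h2 a b ha hb =>
    rw [MulMemClass.coe_mul, map_mul, MulOpposite.unop_mul]
    exact mul_mem hb ha
  | h3 a b ha hb =>
    rw [AddMemClass.coe_add, map_add, MulOpposite.unop_add]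
    exact add_mem ha hb

/-- The antipode of the dense Hopf *-algebra. -/
noncomputable def antipodeCore : core n →ₗ[ℂ] core n where
  toFun a := ⟨(antipodeHom n a).unop, unop_antipodeHom_mem n a⟩
  map_add' a b := Subtype.ext (congrArg MulOpposite.unop (map_add (antipodeHom n) (a : Aaut n) b))
  map_smul' c a := Subtype.ext (congrArg MulOpposite.unop (map_smul (antipodeHom n) c (a : Aaut n)))

theorem antipodeCore_mul (a b : core n) :
    antipodeCore n (a * b) = antipodeCore n b * antipodeCore n a :=
  Subtype.ext (congrArg MulOpposite.unop (map_mul (antipodeHom n) (a : Aaut n) b))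

theorem antipodeCore_star (a : core n) : antipodeCore n (star a) = star (antipodeCore n a) :=
  
  Subtype.ext (congrArg MulOpposite.unop (map_star (antipodeHom n) (a : Aaut n)))

theorem antipodeCore_one : antipodeCore n 1 = 1 := 
  Subtype.ext (congrArg MulOpposite.unop (map_one (antipodeHom n)))

variable {n} in
theorem antipodeCore_cgen (k l i j : Fin n) : antipodeCore n (cgen k l i j) = cgen j i l k :=
  Subtype.ext (congrArg MulOpposite.unop (lift_agen (isAutFamily_agen n).op k l i j))

theorem norm_antipodeCore_le (a : core n) : ‖antipodeCore n a‖ ≤ ‖a‖ :=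
  NonUnitalStarAlgHom.norm_apply_le (antipodeHom n) (a : Aaut n)

/-- The Hopf *-algebra structure of the dense *-subalgebra. -/
noncomputable def hopfCore : HopfStarStructure (core n) :=
  hopfOfAutFamily (isAutFamily_cgen n) core_induction (comulCore n) comulCore_cgen
    ((counitHom n).comp (core n).subtype) (lift_agen (isAutFamily_one n ℂ)) (antipodeCore n)
    antipodeCore_cgen (antipodeCore_one n) (antipodeCore_mul n)

/-- The quantum automorphism group of `M_n` with its trace, as a compact quantum group. -/
noncomputable def quantumGroup : CompactQuantumGroup (Aaut n) where
  comul := comulHom n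
  core := core n
  dense_core := UniversalCStarAlgebra.dense_core
  hopf := hopfCore n
  comul_core a := (of_comulCore n a).symm
  full := UniversalCStarAlgebra.le_norm_core

theorem isKac_quantumGroup : (quantumGroup n).IsKac :=
  ⟨antipodeCore_mul n, antipodeCore_star n, 1, fun a =>
    (norm_antipodeCore_le n a).trans_eq (one_mul _).symm⟩

end Aaut

/-! ### Matrix units -/

/-- The multiplication of two matrices over a ring, in terms of matrix units. -/
theorem sum_mul_sum_of_mul_eq_ite {n : ℕ} {D : Type*} [Ring D] {F G : Fin n → Fin n → D}
    {R : Fin n → Fin n → Fin n → D} (h : ∀ k l p q, F k l * G p q = if l = p then R k l q else 0) :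
    (∑ k, ∑ l, F k l) * (∑ p, ∑ q, G p q) = ∑ k, ∑ q, ∑ l, R k l q := by
  rw [Finset.sum_mul]
  refine Finset.sum_congr rfl fun k _ => ?_
  rw [Finset.sum_mul]
  refine Eq.trans (Finset.sum_congr rfl fun l _ => ?_) Finset.sum_comm
  simp only [Finset.mul_sum, h, Finset.sum_ite_irrel, Finset.sum_const_zero, Finset.sum_ite_eq,
    Finset.mem_univ, if_true]

section MatUnit

variable {n : ℕ}

theorem matUnit_apply (i j k l : Fin n) :
    (matUnit i j : MatAlg n) k l = if i = k ∧ j = l then 1 else 0 := by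
  change Matrix.single i j (1 : ℂ) k l = _
  rw [Matrix.single_apply]

theorem matUnit_mul (i j k l : Fin n) :
    (matUnit i j * matUnit k l : MatAlg n) = if j = k then matUnit i l else 0 := by
  change (Matrix.single i j (1 : ℂ) * Matrix.single k l (1 : ℂ) : Matrix _ _ ℂ) = _
  split_ifs with h
  · subst h
    rw [Matrix.single_mul_single_same, mul_one]
    rfl
  · rw [Matrix.single_mul_single_of_ne _ _ _ _ h]
    rfl

theorem star_matUnit (i j : Fin n) : star (matUnit i j : MatAlg n) = matUnit j i := by
  refine CStarMatrix.ext fun k l => ?_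
  rw [CStarMatrix.star_apply, matUnit_apply, matUnit_apply]
  simp [and_comm, apply_ite star]

theorem sum_smul_matUnit (b : MatAlg n) : ∑ i, ∑ j, b i j • matUnit i j = b := by
  refine Eq.trans (Finset.sum_congr rfl fun i _ => Finset.sum_congr rfl fun j _ => ?_)
    (Matrix.matrix_eq_sum_single (CStarMatrix.ofMatrix.symm b)).symm
  change b i j • Matrix.single i j (1 : ℂ) = _
  rw [Matrix.smul_single, smul_eq_mul, mul_one]
  rfl

theorem sum_matUnit : ∑ i, matUnit i i = (1 : MatAlg n) := by
  rw [← sum_smul_matUnit (1 : MatAlg n)]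
  simp [CStarMatrix.one_apply, ite_smul]

theorem matAlg_linearMap_ext {M : Type*} [AddCommMonoid M] [Module ℂ M] {f g : MatAlg n →ₗ[ℂ] M}
    (h : ∀ i j, f (matUnit i j) = g (matUnit i j)) : f = g :=
  LinearMap.ext fun b => by
    rw [← sum_smul_matUnit b]
    simp only [map_sum, map_smul, h]

theorem matAlg_hom_ext {D : Type*} [Semiring D] [StarRing D] [Algebra ℂ D]
    {f g : MatAlg n →⋆ₐ[ℂ] D} (h : ∀ i j, f (matUnit i j) = g (matUnit i j)) : f = g :=
  DFunLike.ext _ _ fun b => LinearMap.congr_fun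
    (matAlg_linearMap_ext (f := f.toAlgHom.toLinearMap) (g := g.toAlgHom.toLinearMap) h) b

theorem matTrace_matUnit (i j : Fin n) : matTrace n (matUnit i j) = if i = j then 1 else 0 := by
  change ∑ k, (matUnit i j : MatAlg n) k k = _
  simp only [matUnit_apply, ite_and, Finset.sum_ite_eq, Finset.mem_univ, if_true]
  simp only [eq_comm]

theorem matTrace_star_mul_self_nonneg (x : MatAlg n) : 0 ≤ matTrace n (star x * x) := by
  change 0 ≤ ∑ k, (star x * x : MatAlg n) k k
  refine Finset.sum_nonneg fun k _ => ?_
  rw [CStarMatrix.mul_apply]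
  exact Finset.sum_nonneg fun l _ => by
    rw [CStarMatrix.star_apply]; exact star_mul_self_nonneg _

/-- A matrix coefficient, as a linear functional. -/
def coeffFunctional (k l : Fin n) : MatAlg n →ₗ[ℂ] ℂ where
  toFun b := b k l
  map_add' _ _ := rfl
  map_smul' _ _ := rfl

@[simp] theorem coeffFunctional_matUnit (i j k l : Fin n) :
    coeffFunctional k l (matUnit i j) = if i = k ∧ j = l then 1 else 0 := matUnit_apply i j k l

variable {D : Type*} [Ring D] [StarRing D] [Algebra ℂ D] [StarModule ℂ D]

/-- The *-homomorphism of the matrix algebra determined by a system of matrix units `F`. -/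
noncomputable def matUnitHom (F : Fin n → Fin n → D)
    (hmul : ∀ i j r s, F i j * F r s = if j = r then F i s else 0)
    (hstar : ∀ i j, star (F i j) = F j i) (hone : ∑ i, F i i = 1) : MatAlg n →⋆ₐ[ℂ] D :=
  have hmap_one : ∑ i, ∑ j, (1 : MatAlg n) i j • F i j = 1 := by
    simp [CStarMatrix.one_apply, ite_smul, hone]
  { toFun := fun b => ∑ i, ∑ j, b i j • F i j
    map_one' := hmap_one
    map_mul' := fun a b => by
      calc ∑ i, ∑ s, (a * b : MatAlg n) i s • F i s
          = ∑ i, ∑ j, ∑ s, (a i j * b j s) • F i s := by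
            refine Finset.sum_congr rfl fun i _ => ?_
            simp only [CStarMatrix.mul_apply, Finset.sum_smul]
            exact Finset.sum_comm
        _ = ∑ i, ∑ s, ∑ j, (a i j * b j s) • F i s :=
            Finset.sum_congr rfl fun i _ => Finset.sum_comm
        _ = _ := (sum_mul_sum_of_mul_eq_ite fun i j r s => by
            rw [smul_mul_smul_comm, hmul]
            split_ifs with h
            · rw [h]
            · rw [smul_zero]).symm
    map_zero' := by simp
    map_add' := fun a b => by simp [add_smul, Finset.sum_add_distrib]
    commutes' := fun c => by
      rw [Algebra.algebraMap_eq_smul_one, Algebra.algebraMap_eq_smul_one, ← hmap_one]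
      simp only [Finset.smul_sum, CStarMatrix.smul_apply, smul_assoc]
    map_star' := fun a => by
      simp only [star_sum, star_smul, hstar, CStarMatrix.star_apply]
      exact Finset.sum_comm }

theorem matUnitHom_matUnit (F : Fin n → Fin n → D)
    (hmul : ∀ i j r s, F i j * F r s = if j = r then F i s else 0)
    (hstar : ∀ i j, star (F i j) = F j i) (hone : ∑ i, F i i = 1) (i j : Fin n) :
    matUnitHom F hmul hstar hone (matUnit i j) = F i j := by
  change ∑ k, ∑ l, (matUnit i j : MatAlg n) k l • F k l = F i j
  simp [matUnit_apply, ite_smul, ite_and]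

end MatUnit

section Action

variable {n : ℕ} {C : Type*} [CStarAlgebra C]

/-- Elements of `M_n ⊗ C` are determined by their coefficients. -/
theorem sum_tmul_matUnit_injective {x y : Fin n → Fin n → C}
    (h : ∑ k, ∑ l, MinTensor.tmul (matUnit k l) (x k l) =
      ∑ k, ∑ l, MinTensor.tmul (matUnit k l) (y k l)) : x = y := by
  simp only [MinTensor.tmul, ← map_sum] at h
  have h2 := MinTensor.of_injective h
  funext k l
  have h3 := congrArg (algSlice (coeffFunctional k l)) h2
  simpa [ite_and, ite_smul] using h3

theorem sum_tmul_matUnit_mul (x y : Fin n → Fin n → C) :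
    (∑ k, ∑ l, MinTensor.tmul (matUnit k l) (x k l)) *
      (∑ k, ∑ l, MinTensor.tmul (matUnit k l) (y k l)) =
      ∑ k, ∑ l, MinTensor.tmul (matUnit k l) (∑ v, x k v * y v l) := by
  have hs : ∀ (b : MatAlg n) (f : Fin n → C), MinTensor.tmul b (∑ v, f v) =
      ∑ v, MinTensor.tmul b (f v) := fun b f => by simp [MinTensor.tmul, TensorProduct.tmul_sum]
  simp only [hs]
  refine sum_mul_sum_of_mul_eq_ite fun k l p q => ?_
  rw [MinTensor.tmul_mul_tmul, matUnit_mul]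
  split_ifs with h
  · rw [h]
  · simp [MinTensor.tmul]

theorem sum_tmul_matUnit_one :
    ∑ k, ∑ l, MinTensor.tmul (matUnit k l) (if k = l then (1 : C) else 0) =
      (1 : MinTensor (MatAlg n) C) := by
  rw [MinTensor.one_def, ← sum_matUnit]
  simp only [MinTensor.tmul, TensorProduct.sum_tmul, map_sum]
  refine Finset.sum_congr rfl fun k _ => ?_
  rw [Finset.sum_eq_single k]
  · rw [if_pos rfl]
  · intro l _ h
    rw [if_neg h.symm, TensorProduct.tmul_zero, map_zero]
  · simp

theorem sum_sum_tmul_matUnit (f : Fin n → Fin n → Fin n → C) :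
    ∑ i, ∑ k, ∑ l, MinTensor.tmul (matUnit k l) (f i k l) =
      ∑ k, ∑ l, MinTensor.tmul (matUnit k l) (∑ i, f i k l) := by
  rw [Finset.sum_comm]
  refine Finset.sum_congr rfl fun k _ => ?_
  rw [Finset.sum_comm]
  simp [MinTensor.tmul, TensorProduct.tmul_sum]

/-- The action of a family of elements that satisfies the relations on the matrix algebra. -/
noncomputable def actionHom {u : Fin n → Fin n → Fin n → Fin n → C} (hu : IsAutFamily u) :
    MatAlg n →⋆ₐ[ℂ] MinTensor (MatAlg n) C :=
  matUnitHom (fun i j => ∑ k, ∑ l, MinTensor.tmul (matUnit k l) (u k l i j))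
    (fun i j r s => by
      rw [sum_tmul_matUnit_mul]
      simp only [hu.mul]
      split_ifs <;> simp [MinTensor.tmul])
    (fun i j => by
      simp only [star_sum, MinTensor.star_tmul, star_matUnit, hu.adj]
      exact Finset.sum_comm)
    (by simp only [sum_sum_tmul_matUnit, hu.unit, sum_tmul_matUnit_one])

theorem actionHom_matUnit {u : Fin n → Fin n → Fin n → Fin n → C} (hu : IsAutFamily u)
    (i j : Fin n) : actionHom hu (matUnit i j) =
      ∑ k, ∑ l, MinTensor.tmul (matUnit k l) (u k l i j) := matUnitHom_matUnit _ _ _ _ i j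

end Action

/-! ### Actions on the matrix algebra and matrix corepresentations -/

section TopAlgebra

variable {n : ℕ}

/-- The matrix units, as elements of the improper *-subalgebra. -/
def topUnit (i j : Fin n) : (⊤ : StarSubalgebra ℂ (MatAlg n)) := ⟨matUnit i j, trivial⟩

/-- The matrix coefficients, on the improper *-subalgebra. -/
noncomputable def topCoeff (k l : Fin n) : (⊤ : StarSubalgebra ℂ (MatAlg n)) →ₗ[ℂ] ℂ :=
  coeffFunctional k l ∘ₗ (⊤ : StarSubalgebra ℂ (MatAlg n)).subtype.toAlgHom.toLinearMap

@[simp] theorem topCoeff_topUnit (i j k l : Fin n) :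
    topCoeff k l (topUnit i j) = if i = k ∧ j = l then 1 else 0 := matUnit_apply i j k l

theorem sum_smul_topUnit (b : (⊤ : StarSubalgebra ℂ (MatAlg n))) :
    ∑ k, ∑ l, topCoeff k l b • topUnit k l = b := by
  refine Subtype.ext ((?_ : _ = _).trans (sum_smul_matUnit (b : MatAlg n)))
  rw [AddSubmonoidClass.coe_finsetSum]
  refine Finset.sum_congr rfl fun k _ => ?_
  rw [AddSubmonoidClass.coe_finsetSum]
  rfl

theorem top_linearMap_ext {M : Type*} [AddCommMonoid M] [Module ℂ M]
    {f g : (⊤ : StarSubalgebra ℂ (MatAlg n)) →ₗ[ℂ] M}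
    (h : ∀ i j, f (topUnit i j) = g (topUnit i j)) : f = g :=
  LinearMap.ext fun b => by
    rw [← sum_smul_topUnit b]
    simp only [map_sum, map_smul, h]

/-- A tensor is the sum of its slices. -/
theorem sum_topUnit_tmul_algSlice {N : Type*} [AddCommGroup N] [Module ℂ N]
    (t : (⊤ : StarSubalgebra ℂ (MatAlg n)) ⊗[ℂ] N) :
    ∑ k, ∑ l, topUnit k l ⊗ₜ[ℂ] algSlice (topCoeff k l) t = t := by
  induction t with
  | zero => simp
  | add s t hs ht => simp only [map_add, TensorProduct.tmul_add, Finset.sum_add_distrib, hs, ht]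
  | tmul b c =>
    simp only [algSlice_tmul, ← TensorProduct.smul_tmul, ← TensorProduct.sum_tmul,
      sum_smul_topUnit]

/-- A dense *-subalgebra of the matrix algebra is the whole algebra. -/
theorem eq_top_of_dense {B₀ : StarSubalgebra ℂ (MatAlg n)} (h : Dense (B₀ : Set (MatAlg n))) :
    B₀ = ⊤ := by
  have : FiniteDimensional ℂ (MatAlg n) :=
    inferInstanceAs (FiniteDimensional ℂ (Matrix (Fin n) (Fin n) ℂ))
  have hc : IsClosed (B₀ : Set (MatAlg n)) :=
    Submodule.closed_of_finiteDimensional (Subalgebra.toSubmodule B₀.toSubalgebra)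
  refine SetLike.coe_injective ?_
  rw [← hc.closure_eq, h.closure_eq]
  rfl

/-- The linear map with `e_ij ↦ ∑ e_kl ⊗ w_ij^kl`. -/
noncomputable def coactionMap {N : Type*} [AddCommGroup N] [Module ℂ N]
    (w : Fin n → Fin n → Fin n → Fin n → N) :
    (⊤ : StarSubalgebra ℂ (MatAlg n)) →ₗ[ℂ] (⊤ : StarSubalgebra ℂ (MatAlg n)) ⊗[ℂ] N :=
  ∑ i, ∑ j, (topCoeff i j).smulRight (∑ k, ∑ l, topUnit k l ⊗ₜ[ℂ] w k l i j)

theorem coactionMap_topUnit {N : Type*} [AddCommGroup N] [Module ℂ N]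
    (w : Fin n → Fin n → Fin n → Fin n → N) (i j : Fin n) :
    coactionMap w (topUnit i j) = ∑ k, ∑ l, topUnit k l ⊗ₜ[ℂ] w k l i j := by
  simp only [coactionMap, LinearMap.sum_apply, LinearMap.smulRight_apply, topCoeff_topUnit,
    ite_smul, one_smul, zero_smul, ite_and, Finset.sum_ite_irrel, Finset.sum_const_zero,
    Finset.sum_ite_eq, Finset.mem_univ, if_true]

end TopAlgebra

namespace CompactQuantumGroup

variable {n : ℕ} {A : Type*} [CStarAlgebra A]

/-- A matrix corepresentation `w` of a compact quantum group whose entries are the coefficients of a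
homomorphism `α` defines an action. -/
theorem isAction_of_family (G : CompactQuantumGroup A) (α : MatAlg n →⋆ₐ[ℂ] MinTensor (MatAlg n) A)
    (w : Fin n → Fin n → Fin n → Fin n → G.core)
    (hα : ∀ i j, α (matUnit i j) = ∑ k, ∑ l, MinTensor.tmul (matUnit k l) (w k l i j : A))
    (hΔ : ∀ k l i j, G.hopf.comul (w k l i j) = ∑ r, ∑ s, w k l r s ⊗ₜ w r s i j)
    (hε : ∀ k l i j, G.hopf.counit (w k l i j) = if k = i ∧ l = j then 1 else 0) :
    G.IsAction α := by
  refine ⟨⊤, dense_univ, coactionMap w, fun b => ?_, ?_, ?_⟩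
  · let f : (⊤ : StarSubalgebra ℂ (MatAlg n)) →ₗ[ℂ] MinTensor (MatAlg n) A :=
      α.toAlgHom.toLinearMap ∘ₗ (⊤ : StarSubalgebra ℂ (MatAlg n)).subtype.toAlgHom.toLinearMap
    let g : (⊤ : StarSubalgebra ℂ (MatAlg n)) →ₗ[ℂ] MinTensor (MatAlg n) A :=
      (MinTensor.of _ _).toAlgHom.toLinearMap ∘ₗ (Algebra.TensorProduct.map
        (⊤ : StarSubalgebra ℂ (MatAlg n)).subtype.toAlgHom
          G.core.subtype.toAlgHom).toLinearMap ∘ₗ coactionMap w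
    have h : f = g := top_linearMap_ext fun i j => by
      refine (hα i j).trans ?_
      simp only [g, LinearMap.comp_apply, coactionMap_topUnit, map_sum]
      rfl
    exact LinearMap.congr_fun h b
  · refine top_linearMap_ext fun i j => ?_
    have hΔ' : ∀ k l i j, G.hopf.comul.toAlgHom.toLinearMap (w k l i j) =
        ∑ r, ∑ s, w k l r s ⊗ₜ w r s i j := hΔ
    simp only [LinearMap.comp_apply, coactionMap_topUnit, map_sum, LinearMap.rTensor_tmul,
      LinearMap.lTensor_tmul, hΔ', TensorProduct.sum_tmul, TensorProduct.tmul_sum,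
      LinearEquiv.coe_coe, TensorProduct.assoc_tmul]
    exact sum_comm_pairs fun k l r s => topUnit r s ⊗ₜ (w r s k l ⊗ₜ w k l i j)
  · refine top_linearMap_ext fun i j => ?_
    have hε' : ∀ k l i j, G.hopf.counit.toAlgHom.toLinearMap (w k l i j) =
        if k = i ∧ l = j then 1 else 0 := hε
    simp only [LinearMap.comp_apply, coactionMap_topUnit, map_sum, LinearMap.lTensor_tmul, hε']
    rw [Finset.sum_eq_single i, Finset.sum_eq_single j]
    · simp
    all_goals simp +contextual

/-- The coefficients of an action on the matrix algebra. -/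
theorem IsAction.exists_family {G : CompactQuantumGroup A}
    {α : MatAlg n →⋆ₐ[ℂ] MinTensor (MatAlg n) A} (h : G.IsAction α) :
    ∃ w : Fin n → Fin n → Fin n → Fin n → G.core,
      (∀ i j, α (matUnit i j) = ∑ k, ∑ l, MinTensor.tmul (matUnit k l) (w k l i j : A)) ∧
      (∀ k l i j, G.hopf.comul (w k l i j) = ∑ r, ∑ s, w k l r s ⊗ₜ w r s i j) ∧
      ∀ k l i j, G.hopf.counit (w k l i j) = if k = i ∧ l = j then 1 else 0 := by
  obtain ⟨B₀, hB, ρ, hρ, hc, he⟩ := h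
  obtain rfl := eq_top_of_dense hB
  refine ⟨fun k l i j => algSlice (topCoeff k l) (ρ (topUnit i j)), fun i j => ?_,
    fun k l i j => ?_, fun k l i j => ?_⟩
  · refine (hρ (topUnit i j)).trans ?_
    conv_lhs => rw [← sum_topUnit_tmul_algSlice (ρ (topUnit i j))]
    simp only [map_sum]
    rfl
  · have h := congrArg (algSlice (topCoeff k l)) (LinearMap.congr_fun hc (topUnit i j))
    set w : Fin n → Fin n → Fin n → Fin n → G.core :=
      fun k l i j => algSlice (topCoeff k l) (ρ (topUnit i j))
    have hρw : ∀ i j, ρ (topUnit i j) = ∑ k, ∑ l, topUnit k l ⊗ₜ w k l i j := fun i j =>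
      (sum_topUnit_tmul_algSlice _).symm
    simp only [LinearMap.comp_apply, hρw, map_sum, LinearMap.rTensor_tmul,
      LinearMap.lTensor_tmul, TensorProduct.sum_tmul, LinearEquiv.coe_coe,
      TensorProduct.assoc_tmul, algSlice_tmul, topCoeff_topUnit, ite_smul, one_smul, zero_smul,
      ite_and, Finset.sum_ite_irrel, Finset.sum_const_zero, Finset.sum_ite_eq', Finset.mem_univ,
      if_true] at h
    exact h.symm
  · have h := congrArg (algSlice (topCoeff k l)) (LinearMap.congr_fun he (topUnit i j))
    set w : Fin n → Fin n → Fin n → Fin n → G.core :=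
      fun k l i j => algSlice (topCoeff k l) (ρ (topUnit i j))
    have hρw : ∀ i j, ρ (topUnit i j) = ∑ k, ∑ l, topUnit k l ⊗ₜ w k l i j := fun i j =>
      (sum_topUnit_tmul_algSlice _).symm
    simp only [LinearMap.comp_apply, hρw, map_sum, LinearMap.lTensor_tmul, LinearMap.flip_apply,
      TensorProduct.mk_apply, algSlice_tmul, topCoeff_topUnit, ite_smul, one_smul, zero_smul,
      ite_and, Finset.sum_ite_irrel, Finset.sum_const_zero, Finset.sum_ite_eq', Finset.mem_univ,
      if_true] at h
    refine h.trans ?_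
    simp only [ite_and, eq_comm]

end CompactQuantumGroup

/-! ### The universal property -/

namespace CompactQuantumGroup

variable {n : ℕ} {A : Type*} [CStarAlgebra A]

/-- The trace is invariant under a *-homomorphism if and only if its coefficients satisfy the trace
relations. -/
theorem invariant_matTrace_iff (α : MatAlg n →⋆ₐ[ℂ] MinTensor (MatAlg n) A)
    (u : Fin n → Fin n → Fin n → Fin n → A)
    (hα : ∀ i j, α (matUnit i j) = ∑ k, ∑ l, MinTensor.tmul (matUnit k l) (u k l i j)) :
    Invariant (matTrace n) α ↔ ∀ k l, ∑ r, u r r k l = if k = l then 1 else 0 := by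
  have hS : ∀ S : MinTensor (MatAlg n) A →L[ℂ] A,
      (∀ b a, S (MinTensor.tmul b a) = matTrace n b • a) →
      ∀ i j, S (α (matUnit i j)) = ∑ r, u r r i j := fun S hS i j => by
    simp only [hα, map_sum, hS, matTrace_matUnit, ite_smul, one_smul, zero_smul,
      Finset.sum_ite_eq, Finset.mem_univ, if_true]
  constructor
  · rintro ⟨S, hS1, hS2⟩ k l
    rw [← hS S hS1, hS2, matTrace_matUnit]
    simp
  · intro h
    obtain ⟨S, hS0⟩ := MinTensor.exists_slice (B := A) (matTrace n).toLinearMap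
      matTrace_star_mul_self_nonneg
    have hS1 : ∀ b a, S (MinTensor.tmul b a) = matTrace n b • a := fun b a =>
      (hS0 _).trans (algSlice_tmul _ _ _)
    refine ⟨S, hS1, fun b => ?_⟩
    have e : S.toLinearMap ∘ₗ α.toAlgHom.toLinearMap =
        (matTrace n).toLinearMap.smulRight (1 : A) := matAlg_linearMap_ext fun i j => by
      refine (hS S hS1 i j).trans ?_
      rw [h, LinearMap.smulRight_apply]
      change _ = matTrace n (matUnit i j) • (1 : A)
      rw [matTrace_matUnit]
      simp
    exact LinearMap.congr_fun e b

/-- The coefficients of a quantum transformation group of the matrix algebra with its trace satisfy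
the defining relations. -/
theorem IsTransformationGroup.exists_family {G : CompactQuantumGroup A}
    {α : MatAlg n →⋆ₐ[ℂ] MinTensor (MatAlg n) A} (h : IsTransformationGroup (matTrace n) G α) :
    ∃ u : Fin n → Fin n → Fin n → Fin n → A, IsAutFamily u ∧
      (∀ i j, α (matUnit i j) = ∑ k, ∑ l, MinTensor.tmul (matUnit k l) (u k l i j)) ∧
      ∀ k l i j, G.comul (u k l i j) = ∑ r, ∑ s, MinTensor.tmul (u k l r s) (u r s i j) := by
  obtain ⟨hact, hinv⟩ := h
  obtain ⟨w, hα, hΔ, hε⟩ := hact.exists_family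
  set u : Fin n → Fin n → Fin n → Fin n → A := fun k l i j => (w k l i j : A) with hu
  refine ⟨u, ?_, hα, fun k l i j => ?_⟩
  · refine IsAutFamily.of_rightInverse (fun i j k l r s => ?_) (fun i j k l => ?_) (fun k l => ?_)
      ((invariant_matTrace_iff α u hα).1 hinv)
      (fun k l i j => (G.hopf.antipode (w k l i j) : A)) fun i j k l => ?_
    · have h1 := map_mul α (matUnit i j) (matUnit r s)
      rw [hα, hα, sum_tmul_matUnit_mul, matUnit_mul] at h1
      have h2 : α (if j = r then matUnit i s else 0) = ∑ k, ∑ l, MinTensor.tmul (matUnit k l)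
          (if j = r then u k l i s else 0) := by
        split_ifs
        · exact hα i s
        · simp [MinTensor.tmul]
      rw [h2] at h1
      exact (congrFun (congrFun (sum_tmul_matUnit_injective h1) k) l).symm
    · have h1 := map_star α (matUnit i j)
      rw [star_matUnit, hα, hα] at h1
      simp only [star_sum, MinTensor.star_tmul, star_matUnit] at h1
      have h2 := h1.trans Finset.sum_comm
      exact (congrFun (congrFun (sum_tmul_matUnit_injective h2) l) k).symm
    · have h1 := map_one α
      rw [← sum_matUnit, map_sum, ← sum_tmul_matUnit_one] at h1
      simp only [hα, sum_sum_tmul_matUnit] at h1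
      exact congrFun (congrFun (sum_tmul_matUnit_injective h1) k) l
    -- the antipode provides a right inverse of the matrix of coefficients
    · have h1 := LinearMap.congr_fun G.hopf.mul_antipode_lTensor_comul (w k l i j)
      change LinearMap.mul' ℂ _ (G.hopf.antipode.lTensor _ (G.hopf.comul (w k l i j))) =
        algebraMap ℂ _ (G.hopf.counit (w k l i j)) at h1
      rw [hΔ, hε] at h1
      simp only [map_sum, LinearMap.lTensor_tmul, LinearMap.mul'_apply] at h1
      have h2 := congrArg G.core.subtype h1
      simp only [map_sum, map_mul] at h2
      refine h2.trans ?_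
      split_ifs <;> simp
  · rw [G.comul_core, hΔ]
    simp only [map_sum]
    rfl

end CompactQuantumGroup

namespace Aaut

open CompactQuantumGroup

variable (n : ℕ)

/-- The fundamental action on the matrix algebra. -/
noncomputable def action : MatAlg n →⋆ₐ[ℂ] MinTensor (MatAlg n) (Aaut n) :=
  actionHom (isAutFamily_agen n)

variable {n} in
theorem action_matUnit (i j : Fin n) : action n (matUnit i j) =
    ∑ k, ∑ l, MinTensor.tmul (matUnit k l) (agen k l i j) := actionHom_matUnit _ i j

theorem isTransformationGroup : IsTransformationGroup (matTrace n) (quantumGroup n) (action n) :=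
  ⟨isAction_of_family (quantumGroup n) (action n) cgen action_matUnit comulCore_cgen
    (lift_agen (isAutFamily_one n ℂ)),
    (invariant_matTrace_iff (action n) agen action_matUnit).2 (isAutFamily_agen n).trace⟩

variable {n} in
/-- The quantum transformation group on `Aaut n` is final: its fundamental matrix is mapped to the
matrix of coefficients of the given action. -/
theorem existsUnique_morphism {A : Type*} [CStarAlgebra A] (G : CompactQuantumGroup A)
    (α : MatAlg n →⋆ₐ[ℂ] MinTensor (MatAlg n) A) (h : IsTransformationGroup (matTrace n) G α) :
    ∃! π : Aaut n →⋆ₐ[ℂ] A, IsMorphism G α (quantumGroup n) (action n) π := by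
  obtain ⟨u, hu, hα, hΔ⟩ := h.exists_family
  have hmap : ∀ (π : Aaut n →⋆ₐ[ℂ] A) i j,
      MinTensor.map (StarAlgHom.id ℂ (MatAlg n)) π (action n (matUnit i j)) =
        ∑ k, ∑ l, MinTensor.tmul (matUnit k l) (π (agen k l i j)) := fun π i j => by
    simp only [action_matUnit, map_sum, MinTensor.map_tmul, StarAlgHom.coe_id, id_eq]
  refine ⟨lift hu, ⟨fun a => ?_, fun b => ?_⟩, fun π hπ => hom_ext fun k l i j => ?_⟩
  · have e : G.comul.comp (lift hu) = (MinTensor.map (lift hu) (lift hu)).comp (comulHom n) :=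
      hom_ext fun k l i j => by
        simp only [StarAlgHom.comp_apply, lift_agen, hΔ, comulHom_agen, map_sum,
          MinTensor.map_tmul]
    exact DFunLike.congr_fun e a
  · have e : α = (MinTensor.map (StarAlgHom.id ℂ (MatAlg n)) (lift hu)).comp (action n) :=
      matAlg_hom_ext fun i j => by
        rw [StarAlgHom.comp_apply, hmap, hα]
        simp only [lift_agen]
    exact DFunLike.congr_fun e b
  · have h1 := hπ.2 (matUnit i j)
    rw [hmap, hα] at h1
    rw [lift_agen]
    exact (congrFun (congrFun (sum_tmul_matUnit_injective h1) k) l).symm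

end Aaut

/-! ### The automorphism group of the matrix algebra -/

section ClosedRange

variable {A B : Type*} [CStarAlgebra A] [CStarAlgebra B]

open scoped CStarAlgebra in
/-- A self-adjoint element of the range of a *-homomorphism lifts without increase of norm: cut a
self-adjoint preimage off by functional calculus. -/
theorem exists_lift_norm_le_of_isSelfAdjoint (f : A →⋆ₐ[ℂ] B) (a : A) (ha : IsSelfAdjoint a) :
    ∃ a' : A, f a' = f a ∧ ‖a'‖ ≤ ‖f a‖ := by
  set c : ℝ := ‖f a‖
  let φ : ℝ → ℝ := fun x => max (-c) (min c x)
  have hφ : Continuous φ := by fun_prop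
  have hfa : IsSelfAdjoint (f a) := ha.map f
  refine ⟨cfc φ a, ?_, norm_cfc_le (norm_nonneg _) fun x _ => ?_⟩
  · obtain _ | _ := subsingleton_or_nontrivial B
    · exact Subsingleton.elim _ _
    rw [StarAlgHomClass.map_cfc (S := ℂ) f φ a hφ.continuousOn (map_continuous f) ha hfa]
    conv_rhs => rw [← cfc_id ℝ (f a)]
    refine cfc_congr fun x hx => ?_
    have h := spectrum.norm_le_norm_of_mem hx
    rw [Real.norm_eq_abs, abs_le] at h
    simp only [φ, id_eq]
    rw [min_eq_right h.2, max_eq_right h.1]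
  · rw [Real.norm_eq_abs, abs_le]
    exact ⟨le_max_left _ _, max_le (neg_le_self (norm_nonneg _)) (min_le_left _ _)⟩

/-- Every element of the range of a *-homomorphism lifts with control of the norm, by the
decomposition into real and imaginary parts. -/
theorem exists_lift_norm_le (f : A →⋆ₐ[ℂ] B) (a : A) :
    ∃ a' : A, f a' = f a ∧ ‖a'‖ ≤ 2 * ‖f a‖ := by
  obtain ⟨x, hx, hx'⟩ := exists_lift_norm_le_of_isSelfAdjoint f _ (realPart a).2
  obtain ⟨y, hy, hy'⟩ := exists_lift_norm_le_of_isSelfAdjoint f _ (imaginaryPart a).2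
  refine ⟨x + Complex.I • y, ?_, ?_⟩
  · rw [map_add, map_smul, hx, hy, ← map_smul, ← map_add, realPart_add_I_smul_imaginaryPart]
  · rw [map_realPart] at hx'
    rw [map_imaginaryPart] at hy'
    have h1 : ‖x‖ ≤ ‖f a‖ := hx'.trans (realPart.norm_le (f a))
    have h2 : ‖y‖ ≤ ‖f a‖ := hy'.trans (imaginaryPart.norm_le (f a))
    refine (norm_add_le _ _).trans ?_
    rw [norm_smul, Complex.norm_I, one_mul]
    linarith

open scoped CStarAlgebra in
/-- A *-homomorphism of C*-algebras with dense range is surjective, since lifts can be chosen with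
control of their norms. -/
theorem surjective_of_denseRange (f : A →⋆ₐ[ℂ] B) (hf : DenseRange f) : Function.Surjective f := by
  let F : NormedAddGroupHom A B :=
    { toFun := f
      map_add' := map_add f
      bound' := ⟨1, fun a => by
        rw [one_mul]; exact NonUnitalStarAlgHom.norm_apply_le f a⟩ }
  have h : F.SurjectiveOnWith F.range 2 := by
    rintro _ ⟨a, rfl⟩
    exact exists_lift_norm_le f a
  have h2 := controlled_closure_of_complete (f := F) two_pos one_pos h
  intro b
  obtain ⟨a, ha, -⟩ := h2 b (hf b)
  exact ⟨a, ha⟩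

end ClosedRange

section Aut

variable {n : ℕ}

theorem matTrace_mul_comm (x y : MatAlg n) : matTrace n (x * y) = matTrace n (y * x) :=
  Matrix.trace_mul_comm (CStarMatrix.ofMatrix.symm x) (CStarMatrix.ofMatrix.symm y)

/-- The trace is the only tracial functional with its value at the unit. -/
theorem eq_matTrace_of_tracial (τ : MatAlg n →ₗ[ℂ] ℂ) (hτ : ∀ x y, τ (x * y) = τ (y * x))
    (h1 : τ 1 = matTrace n 1) (x : MatAlg n) : τ x = matTrace n x := by
  refine LinearMap.congr_fun (matAlg_linearMap_ext (g := (matTrace n).toLinearMap) fun i j => ?_) x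
  change τ (matUnit i j) = matTrace n (matUnit i j)
  rw [matTrace_matUnit]
  have hd : ∀ k l : Fin n, τ (matUnit k k) = τ (matUnit l l) := fun k l => by
    have h := hτ (matUnit k l) (matUnit l k)
    rwa [matUnit_mul, matUnit_mul, if_pos rfl, if_pos rfl] at h
  split_ifs with h
  · subst h
    have hn : (n : ℂ) ≠ 0 := Nat.cast_ne_zero.2 (Fin.pos i).ne'
    rw [← sum_matUnit, map_sum, map_sum] at h1
    simp only [hd _ i, matTrace_matUnit, if_true, Finset.sum_const, Finset.card_univ,
      Fintype.card_fin, nsmul_eq_mul] at h1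
    exact mul_left_cancel₀ hn h1
  · have h2 := hτ (matUnit i i) (matUnit i j)
    rwa [matUnit_mul, matUnit_mul, if_pos rfl, if_neg (Ne.symm h), map_zero] at h2

/-- The matrix of an automorphism of the matrix algebra satisfies the defining relations. -/
theorem isAutFamily_aut (g : MatAlg n ≃⋆ₐ[ℂ] MatAlg n) :
    IsAutFamily fun k l i j => g (matUnit i j) k l := by
  refine IsAutFamily.of_rightInverse (fun i j k l r s => ?_) (fun i j k l => ?_) (fun k l => ?_)
    (fun k l => ?_) (fun k l i j => g.symm (matUnit i j) k l) fun i j k l => ?_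
  · rw [← CStarMatrix.mul_apply, ← map_mul, matUnit_mul]
    split_ifs
    · rfl
    · rw [map_zero]; rfl
  · rw [← CStarMatrix.star_apply, ← map_star, star_matUnit]
  · have h : ∑ r, g (matUnit r r) = 1 := by rw [← map_sum, sum_matUnit, map_one]
    have h2 := congrArg (coeffFunctional k l) h
    rw [map_sum] at h2
    exact h2
  · have h := eq_matTrace_of_tracial
      ((matTrace n).toLinearMap ∘ₗ (g : MatAlg n →⋆ₐ[ℂ] MatAlg n).toAlgHom.toLinearMap)
      (fun x y => by
        change matTrace n (g (x * y)) = matTrace n (g (y * x))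
        rw [map_mul g, map_mul g, matTrace_mul_comm])
      (congrArg (matTrace n) (map_one g)) (matUnit k l)
    rw [matTrace_matUnit] at h
    exact h
  · have h := congrArg (coeffFunctional k l) (g.apply_symm_apply (matUnit i j))
    rw [← sum_smul_matUnit (g.symm (matUnit i j))] at h
    simp only [map_sum, map_smul, smul_eq_mul, coeffFunctional_matUnit] at h
    refine Eq.trans (Finset.sum_congr rfl fun r _ => Finset.sum_congr rfl fun s _ => mul_comm _ _)
      (h.trans ?_)
    simp only [eq_comm]

/-- An injective *-endomorphism of the matrix algebra is an automorphism. -/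
theorem exists_starAlgEquiv (f : MatAlg n →⋆ₐ[ℂ] MatAlg n) (hf : Function.Injective f) :
    ∃ g : MatAlg n ≃⋆ₐ[ℂ] MatAlg n, ∀ x, g x = f x := by
  have : FiniteDimensional ℂ (MatAlg n) :=
    inferInstanceAs (FiniteDimensional ℂ (Matrix (Fin n) (Fin n) ℂ))
  have hs : Function.Surjective f :=
    (LinearMap.injective_iff_surjective (f := f.toAlgHom.toLinearMap)).1 hf
  exact ⟨StarAlgEquiv.ofBijective f ⟨hf, hs⟩, fun x => rfl⟩

theorem isInducing_aut : Topology.IsInducing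
    fun (g : MatAlg n ≃⋆ₐ[ℂ] MatAlg n) (b : MatAlg n) => g b := ⟨rfl⟩

theorem continuous_aut_apply (b : MatAlg n) :
    Continuous fun g : MatAlg n ≃⋆ₐ[ℂ] MatAlg n => g b :=
  (continuous_apply b).comp isInducing_aut.continuous

/-- The automorphism group of the matrix algebra is compact: it is a closed set of isometries of a
finite-dimensional space. -/
instance compactSpace_aut : CompactSpace (MatAlg n ≃⋆ₐ[ℂ] MatAlg n) := by
  have : FiniteDimensional ℂ (MatAlg n) :=
    inferInstanceAs (FiniteDimensional ℂ (Matrix (Fin n) (Fin n) ℂ))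
  have : ProperSpace (MatAlg n) := FiniteDimensional.proper ℂ _
  refine ⟨isInducing_aut.isCompact_iff.2 ?_⟩
  rw [Set.image_univ]
  have hK : IsCompact (Set.univ.pi fun b : MatAlg n => Metric.closedBall (0 : MatAlg n) ‖b‖) :=
    isCompact_univ_pi fun b => isCompact_closedBall _ _
  have hiso : ∀ (g : MatAlg n ≃⋆ₐ[ℂ] MatAlg n) b, ‖g b‖ = ‖b‖ := fun g b =>
    NonUnitalStarAlgHom.norm_map g g.injective b
  refine hK.of_isClosed_subset ?_ ?_
  · have e : Set.range (fun (g : MatAlg n ≃⋆ₐ[ℂ] MatAlg n) (b : MatAlg n) => g b) =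
        {f | f 1 = 1} ∩ (⋂ x, ⋂ y, {f | f (x * y) = f x * f y}) ∩
        (⋂ x, ⋂ y, {f | f (x + y) = f x + f y}) ∩ (⋂ c : ℂ, ⋂ x, {f | f (c • x) = c • f x}) ∩
        (⋂ x, {f | f (star x) = star (f x)}) ∩ ⋂ x, {f | ‖f x‖ = ‖x‖} := by
      ext f
      simp only [Set.mem_range, Set.mem_inter_iff, Set.mem_iInter, Set.mem_ofPred_eq]
      constructor
      · rintro ⟨g, rfl⟩
        exact ⟨⟨⟨⟨⟨map_one g, map_mul g⟩, map_add g⟩, map_smul g⟩, map_star g⟩, hiso g⟩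
      · rintro ⟨⟨⟨⟨⟨h1, hm⟩, ha⟩, hsm⟩, hst⟩, hn⟩
        let φ : MatAlg n →⋆ₐ[ℂ] MatAlg n :=
          { AlgHom.ofLinearMap ⟨⟨f, ha⟩, hsm⟩ h1 hm with map_star' := hst }
        have hφ : Function.Injective φ := (injective_iff_map_eq_zero φ).2 fun x hx => by
          rw [← norm_eq_zero, ← hn x]
          exact norm_eq_zero.2 hx
        obtain ⟨g, hg⟩ := exists_starAlgEquiv φ hφ
        exact ⟨g, funext hg⟩
    rw [e]
    have hc := fun b : MatAlg n => continuous_apply (A := fun _ : MatAlg n => MatAlg n) b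
    refine (((((isClosed_eq (hc 1) continuous_const).inter ?_).inter ?_).inter ?_).inter ?_).inter ?_
    · exact isClosed_iInter fun x => isClosed_iInter fun y =>
        isClosed_eq (hc _) ((hc x).mul (hc y))
    · exact isClosed_iInter fun x => isClosed_iInter fun y =>
        isClosed_eq (hc _) ((hc x).add (hc y))
    · exact isClosed_iInter fun c => isClosed_iInter fun x =>
        isClosed_eq (hc _) ((hc x).const_smul c)
    · exact isClosed_iInter fun x => isClosed_eq (hc _) (hc x).star
    · exact isClosed_iInter fun x => isClosed_eq (hc _).norm continuous_const
  · rintro _ ⟨g, rfl⟩ b -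
    rw [mem_closedBall_zero_iff]
    exact (hiso g b).le

/-- The matrix coefficients, as continuous functions on the automorphism group. -/
noncomputable def autCoeff (k l i j : Fin n) : C(MatAlg n ≃⋆ₐ[ℂ] MatAlg n, ℂ) where
  toFun g := g (matUnit i j) k l
  continuous_toFun := (continuous_apply l).comp
    ((continuous_apply k).comp (continuous_aut_apply (matUnit i j)))

theorem isAutFamily_autCoeff : IsAutFamily (autCoeff (n := n)) where
  mul i j k l r s := ContinuousMap.ext fun g => by
    rw [ContinuousMap.sum_apply, apply_ite (fun f : C(_, ℂ) => f g)]
    exact (isAutFamily_aut g).mul i j k l r s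
  mul' i j k l r s := ContinuousMap.ext fun g => by
    rw [ContinuousMap.sum_apply, apply_ite (fun f : C(_, ℂ) => f g)]
    exact (isAutFamily_aut g).mul' i j k l r s
  adj i j k l := ContinuousMap.ext fun g => (isAutFamily_aut g).adj i j k l
  unit k l := ContinuousMap.ext fun g => by
    rw [ContinuousMap.sum_apply, apply_ite (fun f : C(_, ℂ) => f g)]
    exact (isAutFamily_aut g).unit k l
  trace k l := ContinuousMap.ext fun g => by
    rw [ContinuousMap.sum_apply, apply_ite (fun f : C(_, ℂ) => f g)]
    exact (isAutFamily_aut g).trace k l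

/-- Scalars that satisfy the defining relations come from an automorphism. -/
theorem exists_aut_of_isAutFamily (hn : 0 < n) {u : Fin n → Fin n → Fin n → Fin n → ℂ}
    (hu : IsAutFamily u) :
    ∃ g : MatAlg n ≃⋆ₐ[ℂ] MatAlg n, ∀ k l i j, g (matUnit i j) k l = u k l i j := by
  let F : Fin n → Fin n → MatAlg n := fun i j => CStarMatrix.ofMatrix (.of fun k l => u k l i j)
  have hF : ∀ i j k l, F i j k l = u k l i j := fun i j k l => rfl
  let f : MatAlg n →⋆ₐ[ℂ] MatAlg n := matUnitHom F
    (fun i j r s => CStarMatrix.ext fun k l => by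
      rw [CStarMatrix.mul_apply]
      simp only [hF, hu.mul]
      split_ifs <;> rfl)
    (fun i j => CStarMatrix.ext fun k l => by
      rw [CStarMatrix.star_apply, hF, hF, hu.adj])
    (CStarMatrix.ext fun k l => by
      rw [CStarMatrix.one_apply, ← hu.unit]
      exact map_sum (coeffFunctional k l) (fun i => F i i) Finset.univ)
  have : Nonempty (Fin n) := ⟨⟨0, hn⟩⟩
  have : IsSimpleRing (MatAlg n) := inferInstanceAs (IsSimpleRing (Matrix (Fin n) (Fin n) ℂ))
  have hf : Function.Injective f := RingHom.injective (f : MatAlg n →+* MatAlg n)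
  obtain ⟨g, hg⟩ := exists_starAlgEquiv f hf
  exact ⟨g, fun k l i j => by rw [hg, matUnitHom_matUnit, hF]⟩

end Aut

/-! ### The maximal classical subgroup -/

namespace Aaut

variable (n : ℕ)

/-- The restriction of functions on the quantum automorphism group to the automorphism group. -/
noncomputable def restrictHom : Aaut n →⋆ₐ[ℂ] C(MatAlg n ≃⋆ₐ[ℂ] MatAlg n, ℂ) :=
  lift isAutFamily_autCoeff

/-- The restriction map to the automorphism group, followed by the evaluation at a point. -/
noncomputable def autChar (g : MatAlg n ≃⋆ₐ[ℂ] MatAlg n) : Aaut n →⋆ₐ[ℂ] ℂ :=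
  (ContinuousMap.evalStarAlgHom ℂ ℂ g).comp (restrictHom n)

variable {n}

theorem autChar_agen (g : MatAlg n ≃⋆ₐ[ℂ] MatAlg n) (k l i j : Fin n) :
    autChar n g (agen k l i j) = g (matUnit i j) k l :=
  congrArg (fun f : C(MatAlg n ≃⋆ₐ[ℂ] MatAlg n, ℂ) => f g) (lift_agen isAutFamily_autCoeff k l i j)

theorem aut_ext {g h : MatAlg n ≃⋆ₐ[ℂ] MatAlg n}
    (H : ∀ i j k l, g (matUnit i j) k l = h (matUnit i j) k l) : g = h := by
  have e : (g : MatAlg n →⋆ₐ[ℂ] MatAlg n) = h :=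
    matAlg_hom_ext fun i j => CStarMatrix.ext fun k l => H i j k l
  exact DFunLike.ext _ _ fun x => DFunLike.congr_fun e x

/-- The restriction map is onto by the Stone-Weierstrass theorem, since the matrix coefficients
separate the automorphisms. -/
theorem restrictHom_surjective : Function.Surjective (restrictHom n) := by
  refine surjective_of_denseRange _ ?_
  have h := ContinuousMap.starSubalgebra_topologicalClosure_eq_top_of_separatesPoints
    (restrictHom n).range fun g h hgh => ?_
  · intro f
    have hf : f ∈ (restrictHom n).range.topologicalClosure := h ▸ trivial
    exact hf
  · by_contra H
    push Not at H
    exact hgh (aut_ext fun i j k l =>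
      (autChar_agen g k l i j).symm.trans ((H _ ⟨_, ⟨agen k l i j, rfl⟩, rfl⟩).trans
        (autChar_agen h k l i j)))

/-- The classical points of the quantum group are the automorphisms: a character of `Aaut n` is given
by a matrix of scalars that satisfies the defining relations. -/
theorem containsAut (hn : 0 < n) : ContainsAut (quantumGroup n) (action n) := by
  refine ⟨restrictHom n, restrictHom_surjective, fun g h a => ?_, fun g b => ?_, ?_, fun χ => ?_⟩
  · have hC : ∀ x y : ℂ, MinTensor.tmul x y = MinTensor.tmul (x * y) 1 := fun x y => by
      rw [MinTensor.tmul, MinTensor.tmul, ← mul_one y, ← smul_eq_mul, TensorProduct.tmul_smul,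
        TensorProduct.smul_tmul', smul_eq_mul, smul_eq_mul, mul_one, mul_comm]
    have e : (MinTensor.map (autChar n g) (autChar n h)).comp (comulHom n) =
        (MinTensor.inl ℂ ℂ).comp (autChar n (g * h)) := hom_ext fun k l i j => by
      simp only [StarAlgHom.comp_apply, comulHom_agen, map_sum, MinTensor.map_tmul, autChar_agen]
      have h1 : (g * h) (matUnit i j) = ∑ r, ∑ s, h (matUnit i j) r s • g (matUnit r s) := by
        change g (h (matUnit i j)) = _
        conv_lhs => rw [← sum_smul_matUnit (h (matUnit i j))]
        simp only [map_sum, map_smul]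
      have h2 : (g * h) (matUnit i j) k l =
          ∑ r, ∑ s, g (matUnit r s) k l * h (matUnit i j) r s := by
        have h3 := congrArg (coeffFunctional k l) h1
        simp only [map_sum, map_smul, smul_eq_mul] at h3
        exact h3.trans (Finset.sum_congr rfl fun r _ => Finset.sum_congr rfl fun s _ =>
          mul_comm _ _)
      rw [h2]
      simp only [map_sum, MinTensor.inl_apply]
      exact Finset.sum_congr rfl fun r _ => Finset.sum_congr rfl fun s _ => hC _ _
    refine (DFunLike.congr_fun e a).trans ?_
    rw [StarAlgHom.comp_apply, MinTensor.inl_apply, MinTensor.one_def, MinTensor.tmul,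
      MinTensor.tmul, ← map_smul, TensorProduct.smul_tmul', smul_eq_mul, mul_one]
    rfl
  · have e : (MinTensor.map (StarAlgHom.id ℂ (MatAlg n)) (autChar n g)).comp (action n) =
        (MinTensor.inl (MatAlg n) ℂ).comp (g : MatAlg n →⋆ₐ[ℂ] MatAlg n) :=
      matAlg_hom_ext fun i j => by
        simp only [StarAlgHom.comp_apply, action_matUnit, map_sum, MinTensor.map_tmul,
          autChar_agen, MinTensor.inl_apply, StarAlgHom.coe_id, id_eq]
        have h1 : ((g : MatAlg n →⋆ₐ[ℂ] MatAlg n) (matUnit i j)) = g (matUnit i j) := rfl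
        rw [h1]
        conv_rhs => rw [← sum_smul_matUnit (g (matUnit i j))]
        simp only [MinTensor.tmul, TensorProduct.sum_tmul, map_sum]
        refine Finset.sum_congr rfl fun k _ => Finset.sum_congr rfl fun l _ => ?_
        rw [TensorProduct.smul_tmul, smul_eq_mul, mul_one]
    exact DFunLike.congr_fun e b
  · intro g h hgh
    refine aut_ext fun i j k l => ?_
    rw [← autChar_agen g, ← autChar_agen h]
    exact DFunLike.congr_fun hgh (agen k l i j)
  · obtain ⟨g, hg⟩ := exists_aut_of_isAutFamily hn ((isAutFamily_agen n).map χ)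
    refine ⟨g, hom_ext fun k l i j => ?_⟩
    exact (autChar_agen g k l i j).trans (hg k l i j)

end Aaut

theorem theorem4p1 (n : ℕ) (hn : 0 < n) :
    ∃ (G : CompactQuantumGroup (Aaut n)) (α : MatAlg n →⋆ₐ[ℂ] MinTensor (MatAlg n) (Aaut n)),
      (∀ i j k l : Fin n, G.comul (agen k l i j) =
        ∑ r, ∑ s, MinTensor.tmul (agen k l r s) (agen r s i j)) ∧
      G.IsKac ∧
      (∀ i j : Fin n, α (matUnit i j) = ∑ k, ∑ l, MinTensor.tmul (matUnit k l) (agen k l i j)) ∧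
      IsQuantumAutomorphismGroup.{w} (matTrace n) G α ∧
      IsKacQuantumAutomorphismGroup.{w} (matTrace n) G α ∧
      ContainsAut G α := by
  have hT := Aaut.isTransformationGroup n
  exact ⟨Aaut.quantumGroup n, Aaut.action n, fun i j k l => Aaut.comulHom_agen k l i j,
    Aaut.isKac_quantumGroup n, Aaut.action_matUnit,
    ⟨hT, fun _ _ G' α' h => Aaut.existsUnique_morphism G' α' h⟩,
    ⟨⟨Aaut.isKac_quantumGroup n, hT⟩, fun _ _ G' α' _ h => Aaut.existsUnique_morphism G' α' h⟩,
    Aaut.containsAut hn⟩
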